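/- **Setting.** For each $k\ge 1$ let $n_k,m_k\ge 2$ be integers and let $\mathcal D_k\subseteq\{0,\dots,n_k-1\}\times\{0,\dots,m_k-1\}$ have at least two elements. Assume $N^+=\sup\{n_k,m_k:k\ge1\}<\infty$. Put $\Sigma^\infty=\prod_{k\ge1}\mathcal D_k$ and define $\Pi:\Sigma^\infty\to\mathbb R^2$ by $$\Pi(w_1w_2\ldots)=\sum_{k=1}^\infty \mathrm{diag}\Big(\prod_{h=1}^k n_h^{-1},\prod_{h=1}^k m_h^{-1}\Big)w_k .$$ The image $E=\Pi(\Sigma^\infty)$ is the self-affine Moran set of the construction $\{(n_k,m_k,\mathcal D_k)\}_{k\ge1}$. For each $k$ let $\mathbf p_k=(p_k(w))_{w\in\mathcal D_k}$ be a probability vector (zero entries allowed), $\mathbf p=(\mathbf p_k)_{k\ge1}$, let $\nu_{\mathbf p}=\prod_k\mathbf p_k$ be the product measure on $\Sigma^\infty$, and let $\mu_{\mathbf p}(A)=\nu_{\mathbf p}(\Pi^{-1}A)$ be the self-affine Moran measure on $E$. Put $$q_k(j)=\sum_{i:(i,j)\in\mathcal D_k}p_k(i,j),\qquad \widehat q_k(i)=\sum_{j:(i,j)\in\mathcal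 D_k}p_k(i,j),$$ and write $q_k(w)=q_k(j)$, $\widehat q_k(w)=\widehat q_k(i)$ for $w=(i,j)\in\mathcal D_k$. For $k\ge1$ let $l=l(k)$ be the unique integer with $(n_1\cdots n_l)^{-1}\le(m_1\cdots m_k)^{-1}<(n_1\cdots n_{l-1})^{-1}$, and let the $k$-th entropy be (with $0\log0=0$) $$H_k(\mathbf p)=\begin{cases}-\sum_{i=1}^{l}\sum_{w\in\mathcal D_i}p_i(w)\log p_i(w)-\sum_{i=l+1}^{k}\sum_{w\in\mathcal D_i}p_i(w)\log q_i(w), & l\le k,\\[2pt] -\sum_{i=1}^{k}\sum_{w\in\mathcal D_i}p_i(w)\log p_i(w)-\sum_{i=k+1}^{l}\sum_{w\in\mathcal D_i}p_i(w)\log \widehat q_i(w), & l>k.\end{cases}$$ The set $\mathcal D_k$ is *centred* if $i\notin\{0,n_k-1\}$ and $j\notin\{0,m_k-1\}$ for every $(i,j)\in\mathcal D_k$. The set $E$ (more precisely, its construction) satisfies the *frequency separation condition (FSC)* if there is $c>0$ with $$\lim_{n\to\infty}\frac{\mathrm{card}\{1\le k\le n:\mathcal D_k\text{ is centred}\}}{n}=c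 .$$ The measure $\mu_{\mathbf p}$ satisfies the *measure separation condition (MSC)* if there is a constant $0<C<1$ such that $\max\{q_k(0),q_k(m_k-1),\widehat q_k(0),\widehat q_k(n_k-1)\}<C$ for every $k\ge1$. For a finite Borel measure $\mu$ on $\mathbb R^2$ put $\dim_{\rm H}\mu=\inf\{\dim_{\rm H}A:\mu(A^c)=0\}$ and $\dim_{\rm P}\mu=\inf\{\dim_{\rm P}A:\mu(A^c)=0\}$, where $\dim_{\rm H}A$ and $\dim_{\rm P}A$ are the Hausdorff and packing dimensions of the set $A$. **Theorem.** Suppose that $E$ satisfies FSC or $\mu_{\mathbf p}$ satisfies MSC. Then $$\dim_{\rm H}\mu_{\mathbf p}=\liminf_{k\to\infty}\frac{H_k(\mathbf p)}{\sum_{i=1}^k\log m_i},\qquad \dim_{\rm P}\mu_{\mathbf p}=\limsup_{k\to\infty}\frac{H_k(\mathbf p)}{\sum_{i=1}^k\log m_i}.$$ -/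

import Mathlib

open MeasureTheory Filter Topology
open scoped ENNReal NNReal

noncomputable section

/-! ### Packing dimension of sets, dimensions of measures -/

section Dimensions

variable {X : Type*} [MetricSpace X]

/-- A `δ`-packing of `A`: a countable collection of pairwise disjoint closed balls with centres in
`A` and radii in `(0, δ]`. A ball is recorded as the pair (centre, radius). -/
def IsBallPacking (A : Set X) (δ : ℝ) (T : Set (X × ℝ)) : Prop :=
  T.Countable ∧ (∀ b ∈ T, b.1 ∈ A ∧ 0 < b.2 ∧ b.2 ≤ δ) ∧
    T.PairwiseDisjoint (fun b => Metric.closedBall b.1 b.2)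

/-- `P^s_δ(A)`: the supremum of `∑ (2 r_i) ^ s` over the `δ`-packings of `A` by balls of
radii `r_i`. -/
def packingPreAt (s : ℝ) (δ : ℝ) (A : Set X) : ℝ≥0∞ :=
  ⨆ (T : Set (X × ℝ)) (_ : IsBallPacking A δ T), ∑' b : T, ENNReal.ofReal (2 * b.1.2) ^ s

/-- The packing premeasure `P^s_0(A) = lim_{δ → 0} P^s_δ(A) = inf_{δ > 0} P^s_δ(A)`. -/
def packingPre (s : ℝ) (A : Set X) : ℝ≥0∞ :=
  ⨅ (δ : ℝ) (_ : 0 < δ), packingPreAt s δ A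

/-- The `s`-dimensional packing measure `P^s(A) = inf {∑ P^s_0(A_i) : A ⊆ ⋃ A_i}`, the infimum
being over countable covers of `A`. -/
def packingMeas (s : ℝ) (A : Set X) : ℝ≥0∞ :=
  ⨅ (B : ℕ → Set X) (_ : A ⊆ ⋃ i, B i), ∑' i, packingPre s (B i)

/-- The packing dimension `dim_P A = sup {s ≥ 0 : P^s(A) = ∞}` of a set. -/
def dimPacking (A : Set X) : ℝ≥0∞ :=
  ⨆ (s : ℝ≥0) (_ : packingMeas (s : ℝ) A = ∞), (s : ℝ≥0∞)

/-- The Hausdorff dimension `inf {dim_H A : μ(Aᶜ) = 0}` of a measure. -/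
def hausdorffDimMeasure [MeasurableSpace X] (μ : Measure X) : ℝ≥0∞ :=
  ⨅ (A : Set X) (_ : μ Aᶜ = 0), dimH A

/-- The packing dimension `inf {dim_P A : μ(Aᶜ) = 0}` of a measure. -/
def packingDimMeasure [MeasurableSpace X] (μ : Measure X) : ℝ≥0∞ :=
  ⨅ (A : Set X) (_ : μ Aᶜ = 0), dimPacking A

end Dimensions

/-! ### Self-affine Moran constructions -/

/-- The data `{(n_k, m_k, D_k)}` of a self-affine Moran construction. Levels are numbered from `0`
here, so that `n k`, `m k`, `D k` belong to the level usually numbered `k + 1`. -/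
structure MoranData where
  n : ℕ → ℕ
  m : ℕ → ℕ
  D : ℕ → Finset (ℕ × ℕ)
  two_le_n : ∀ k, 2 ≤ n k
  two_le_m : ∀ k, 2 ≤ m k
  D_subset : ∀ k, D k ⊆ Finset.range (n k) ×ˢ Finset.range (m k)
  two_le_card : ∀ k, 2 ≤ (D k).card

namespace MoranData

/-- The space `Σ^∞ = ∏ D_k` of infinite sequences; it carries the product σ-algebra. -/
abbrev Seq (S : MoranData) : Type := ∀ k, S.D k

/-- The projection `Π(w) = ∑_k diag(∏_{h ≤ k} n_h⁻¹, ∏_{h ≤ k} m_h⁻¹) w_k`. -/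
def proj (S : MoranData) (w : S.Seq) : EuclideanSpace ℝ (Fin 2) :=
  !₂[∑' k, (∏ h ∈ Finset.range (k + 1), (S.n h : ℝ)⁻¹) * ((w k).1.1 : ℝ),
    ∑' k, (∏ h ∈ Finset.range (k + 1), (S.m h : ℝ)⁻¹) * ((w k).1.2 : ℝ)]

/-- The set `𝒫` of sequences of probability vectors `p_k` on `D_k`. -/
abbrev ProbSeq (S : MoranData) : Type := ∀ k, stdSimplex ℝ (S.D k)

/-- The probability measure on `D_k` given by the probability vector `p_k`. -/
def levelMeasure (S : MoranData) (p : S.ProbSeq) (k : ℕ) : Measure (S.D k) :=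
  ∑ w : S.D k, ENNReal.ofReal ((p k).1 w) • Measure.dirac w

instance (S : MoranData) (p : S.ProbSeq) (k : ℕ) : IsProbabilityMeasure (S.levelMeasure p k) := by
  constructor
  simp only [levelMeasure, Measure.coe_finsetSum, Finset.sum_apply, Measure.smul_apply,
    measure_univ, smul_eq_mul, mul_one]
  rw [← ENNReal.ofReal_sum_of_nonneg (fun w _ => (p k).2.1 w), (p k).2.2, ENNReal.ofReal_one]

/-- The product measure `ν_p` on `Σ^∞`, with `ν_p([w_1 … w_k]) = p_1(w_1) ⋯ p_k(w_k)`. -/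
def seqMeasure (S : MoranData) (p : S.ProbSeq) : Measure S.Seq :=
  Measure.infinitePi (S.levelMeasure p)

/-- A series `∑ a_k d_k` with `a_k = (c_0 ⋯ c_k)⁻¹`, `0 ≤ d_k < c_k`, `c_k ≥ 2`, converges. -/
theorem summable_digits {c d : ℕ → ℕ} (hc : ∀ k, 2 ≤ c k) (hd : ∀ k, d k < c k) :
    Summable fun k => (∏ h ∈ Finset.range (k + 1), (c h : ℝ)⁻¹) * (d k : ℝ) := by
  refine Summable.of_nonneg_of_le (fun k => by positivity) (fun k => ?_)
    (summable_geometric_of_lt_one (r := (1 / 2 : ℝ)) (by norm_num) (by norm_num))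
  have hck : (0 : ℝ) < c k := by have := hc k; positivity
  have h1 : ((c k : ℝ)⁻¹) * d k ≤ 1 := by
    rw [inv_mul_le_iff₀ hck, mul_one]
    exact_mod_cast (hd k).le
  have h2 : ∏ h ∈ Finset.range k, (c h : ℝ)⁻¹ ≤ (1 / 2 : ℝ) ^ k := by
    calc ∏ h ∈ Finset.range k, (c h : ℝ)⁻¹ ≤ ∏ _h ∈ Finset.range k, (1 / 2 : ℝ) := by
          refine Finset.prod_le_prod (fun _ _ => by positivity) (fun h _ => ?_)
          rw [one_div]
          exact inv_anti₀ (by norm_num) (by exact_mod_cast hc h)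
      _ = (1 / 2 : ℝ) ^ k := by simp
  rw [Finset.prod_range_succ, mul_assoc]
  calc _ ≤ (1 / 2 : ℝ) ^ k * 1 := by gcongr
    _ = _ := mul_one _

theorem measurable_proj (S : MoranData) : Measurable S.proj := by
  have key : ∀ (c : ℕ → ℕ) (d : S.Seq → ℕ → ℕ), (∀ k, 2 ≤ c k) → (∀ w k, d w k < c k) →
      (∀ k, Measurable fun w => d w k) →
      Measurable fun w => ∑' k, (∏ h ∈ Finset.range (k + 1), (c h : ℝ)⁻¹) * (d w k : ℝ) := by
    intro c d hc hd hm
    refine measurable_of_tendsto_metrizable (f := fun N w => ∑ k ∈ Finset.range N,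
      (∏ h ∈ Finset.range (k + 1), (c h : ℝ)⁻¹) * (d w k : ℝ)) (fun N => ?_) ?_
    · refine Finset.measurable_sum _ (fun k _ => ?_)
      exact ((measurable_from_top (f := fun a : ℕ => (a : ℝ))).comp (hm k)).const_mul _
    · rw [tendsto_pi_nhds]
      exact fun w => (summable_digits hc (hd w)).hasSum.tendsto_sum_nat
  have hD : ∀ (w : S.Seq) k, (w k).1.1 < S.n k ∧ (w k).1.2 < S.m k := fun w k => by
    have := S.D_subset k (w k).2
    simpa using this
  refine (WithLp.measurable_toLp 2 _).comp (measurable_pi_iff.2 fun i => ?_)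
  fin_cases i
  · exact key S.n (fun w k => (w k).1.1) S.two_le_n (fun w k => (hD w k).1) (fun k => by fun_prop)
  · exact key S.m (fun w k => (w k).1.2) S.two_le_m (fun w k => (hD w k).2) (fun k => by fun_prop)

/-- The self-affine Moran measure `μ_p(A) = ν_p(Π⁻¹ A)`. -/
def moranMeasure (S : MoranData) (p : S.ProbSeq) : Measure (EuclideanSpace ℝ (Fin 2)) :=
  (S.seqMeasure p).map S.proj

/-- The row marginal `q_k(j) = ∑_{(i, j) ∈ D_k} p_k(i, j)`. -/
def rowProb (S : MoranData) (p : S.ProbSeq) (k : ℕ) (j : ℕ) : ℝ :=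
  ∑ w : S.D k, if w.1.2 = j then (p k).1 w else 0

/-- The column marginal `q̂_k(i) = ∑_{(i, j) ∈ D_k} p_k(i, j)`. -/
def colProb (S : MoranData) (p : S.ProbSeq) (k : ℕ) (i : ℕ) : ℝ :=
  ∑ w : S.D k, if w.1.1 = i then (p k).1 w else 0

/-- `l(k)`: the least `l` such that `(n_1 ⋯ n_l)⁻¹ ≤ (m_1 ⋯ m_k)⁻¹`; for `k ≥ 1` this is the unique
`l` with `(n_1 ⋯ n_l)⁻¹ ≤ (m_1 ⋯ m_k)⁻¹ < (n_1 ⋯ n_{l-1})⁻¹`. -/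
def ell (S : MoranData) (k : ℕ) : ℕ :=
  sInf {l | ∏ h ∈ Finset.range k, S.m h ≤ ∏ h ∈ Finset.range l, S.n h}

/-- The `k`-th entropy `H_k(p)`, a nonnegative number; `0 log 0 = 0`. -/
def entropy (S : MoranData) (p : S.ProbSeq) (k : ℕ) : ℝ :=
  if S.ell k ≤ k then
    - ((∑ i ∈ Finset.range (S.ell k), ∑ w : S.D i, (p i).1 w * Real.log ((p i).1 w)) +
      ∑ i ∈ Finset.Ico (S.ell k) k, ∑ w : S.D i, (p i).1 w * Real.log (S.rowProb p i w.1.2))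
  else
    - ((∑ i ∈ Finset.range k, ∑ w : S.D i, (p i).1 w * Real.log ((p i).1 w)) +
      ∑ i ∈ Finset.Ico k (S.ell k), ∑ w : S.D i, (p i).1 w * Real.log (S.colProb p i w.1.1))

/-- The ratio `H_k(p) / ∑_{i ≤ k} log m_i`. -/
def entropyRatio (S : MoranData) (p : S.ProbSeq) (k : ℕ) : ℝ :=
  S.entropy p k / ∑ i ∈ Finset.range k, Real.log (S.m i)

/-- `D_k` is centred: it does not meet the boundary rows and columns of the grid. -/
def IsCentred (S : MoranData) (k : ℕ) : Prop :=
  ∀ w ∈ S.D k, w.1 ≠ 0 ∧ w.1 ≠ S.n k - 1 ∧ w.2 ≠ 0 ∧ w.2 ≠ S.m k - 1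

open Classical in
/-- Frequency separation condition: the levels with centred digit set have positive density. -/
def FSC (S : MoranData) : Prop :=
  ∃ c : ℝ, 0 < c ∧ Tendsto
    (fun N : ℕ => (((Finset.range N).filter fun k => S.IsCentred k).card : ℝ) / N) atTop (𝓝 c)

/-- Measure separation condition. -/
def MSC (S : MoranData) (p : S.ProbSeq) : Prop :=
  ∃ C : ℝ, 0 < C ∧ C < 1 ∧ ∀ k,
    S.rowProb p k 0 < C ∧ S.rowProb p k (S.m k - 1) < C ∧
    S.colProb p k 0 < C ∧ S.colProb p k (S.n k - 1) < C

end MoranData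

end

noncomputable section

/-! The plane is resolved by approximate squares. The `k`-th one around `Π(w)` fixes the first
`l(k)` column digits and the first `k` row digits of `w`, so both sides equal `(m_1 ⋯ m_k)⁻¹` up to
a factor `N`. Its product measure is a product of `p_i(w_i)` over the levels where both digits are
fixed and of a marginal over the levels where only one is (`seqMeasure_cell_ell`). Minus its
logarithm is thus a sum of independent variables with mean `H_k`. Their second moments are bounded
because `y (log y)²` is bounded on `[0, 1]`, so the strong law gives measure `exp(-H_k + o(k))`
almost surely (`ae_eventually_abs_cellInfo_sub_le`). As `∑ log m_i ≥ k log 2`, the error `o(k)` does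
not affect the ratio of logarithms.

To pass from squares to balls: the ball of twice the side contains the square, which yields the
upper bounds without any separation. For the lower bounds a ball must see only one square. Either
separation condition provides, within `εk` further levels, digits off the boundary rows and columns,
so a ball smaller by a factor `N ^ (-εk - 2)` pulls back into a single cell
(`ae_eventually_isInner`, `mem_cell_of_dist_lt`).

Local estimates along such scales control the dimensions of the measure: a mass distribution
argument for the Hausdorff lower bound, Vitali's covering lemma for the Hausdorff upper and packing
lower bounds, and disjointness of packings for the packing upper bound. -/

theorem exists_measure_inter_ne_zero {X : Type*} [MeasurableSpace X] {μ : Measure X}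
    {A : Set X} (hA : μ Aᶜ = 0) (hμ : μ ≠ 0) {P : X → Prop}
    (hP : ∀ᵐ x ∂μ, P x) {B : ℕ → Set X} (hB : ∀ x ∈ A, P x → ∃ i, x ∈ B i) :
    ∃ i, μ (A ∩ B i) ≠ 0 := by
  by_contra! h
  have h1 : μ (⋃ i, A ∩ B i) = 0 := measure_iUnion_null h
  have h2 : ∀ᵐ x ∂μ, x ∈ A := by rwa [ae_iff]
  have h3 : ∀ᵐ x ∂μ, x ∉ ⋃ i, A ∩ B i := measure_eq_zero_iff_ae_notMem.1 h1
  have : ∀ᵐ _x ∂μ, False := by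
    filter_upwards [h2, h3, hP] with x hx hx' hx''
    obtain ⟨i, hi⟩ := hB x hx hx''
    exact hx' (Set.mem_iUnion.2 ⟨i, hx, hi⟩)
  exact hμ (by simpa using this)

/-! ### Dimensions of measures from local estimates along a sequence of scales. -/

section LocalDimension

variable {X : Type*} [MetricSpace X]

/-- Places an arbitrary radius or diameter between two consecutive scales; `ρ` need not be monotone.
-/
theorem exists_scale_of_tendsto_zero {ρ : ℕ → ℝ} (hρ : Tendsto ρ atTop (𝓝 0)) {K : ℕ} {d : ℝ}
    (hd : 0 < d) (hK : d ≤ ρ K) : ∃ k, K ≤ k ∧ d ≤ ρ k ∧ ρ (k + 1) < d := by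
  by_contra! h
  have h1 : ∀ k, K ≤ k → d ≤ ρ k := fun k hk =>
    Nat.le_induction hK (fun n hn ih => h n hn ih) k hk
  exact absurd (ge_of_tendsto hρ (eventually_atTop.2 ⟨K, h1⟩)) (not_le.2 hd)

variable [MeasurableSpace X] {μ : Measure X}

/-- If `μ` has upper local dimension at least `t` almost everywhere, then so is its packing
dimension. -/
theorem le_packingDimMeasure [SecondCountableTopology X] (hμ : μ ≠ 0) {ρ : ℕ → ℝ}
    (hρ : Tendsto ρ atTop (𝓝 0)) (hpos : ∀ k, 0 < ρ k) (t : ℝ≥0)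
    (h : ∀ᵐ x ∂μ, ∃ᶠ k in atTop,
      μ (Metric.closedBall x (ρ k)) ≤ ENNReal.ofReal (ρ k) ^ (t : ℝ)) :
    (t : ℝ≥0∞) ≤ packingDimMeasure μ := by
  refine le_iInf₂ fun A hA => le_of_forall_lt_imp_le_of_dense fun s hs => ?_
  lift s to ℝ≥0 using ne_top_of_lt hs
  have hst : (s : ℝ) < t := by exact_mod_cast hs
  refine le_iSup₂_of_le s ?_ le_rfl
  refine iInf₂_eq_top.2 fun B hB => ?_
  obtain ⟨i, hi⟩ := exists_measure_inter_ne_zero hA hμ h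
    (B := fun i => {x | x ∈ B i ∧ ∃ᶠ k in atTop,
      μ (Metric.closedBall x (ρ k)) ≤ ENNReal.ofReal (ρ k) ^ (t : ℝ)})
    (fun x hx hx' => by obtain ⟨i, hi⟩ := Set.mem_iUnion.1 (hB hx); exact ⟨i, hi, hx'⟩)
  set S := A ∩ {x | x ∈ B i ∧ ∃ᶠ k in atTop,
      μ (Metric.closedBall x (ρ k)) ≤ ENNReal.ofReal (ρ k) ^ (t : ℝ)} with hS
  have hpre : packingPre s (B i) = ∞ := by
    refine iInf₂_eq_top.2 fun δ hδ => ?_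
    -- Vitali is applied to balls of radius `ρ k / 5`, so that the enlarged balls are those with a
    -- known measure bound. The disjoint balls form a packing, and the spare power `η ^ (t - s)`
    -- forces `μ S = 0` as `η → 0` unless the packing sums are infinite.
    have bound : ∀ η : ℝ, 0 < η → η ≤ δ →
        μ S ≤ ENNReal.ofReal η ^ ((t : ℝ) - s) * (5 ^ (s : ℝ) * packingPreAt s δ (B i)) := by
      intro η hη hηδ
      set F : Set (X × ℝ) := {b | b.1 ∈ B i ∧ 0 < b.2 ∧ 5 * b.2 ≤ η ∧
        μ (Metric.closedBall b.1 (5 * b.2)) ≤ ENNReal.ofReal (5 * b.2) ^ (t : ℝ)} with hF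
      obtain ⟨u, huF, hdisj, hcov⟩ :=
        Vitali.exists_disjoint_subfamily_covering_enlargement_closedBall F (fun b => b.1)
          (fun b => b.2) η (fun b hb => by have := hb.2.1; have := hb.2.2.1; linarith) 5
          (by norm_num)
      have hcount : u.Countable := hdisj.countable_of_nonempty_interior fun b hb =>
        ⟨b.1, Metric.ball_subset_interior_closedBall (Metric.mem_ball_self (huF hb).2.1)⟩
      have hpack : IsBallPacking (B i) δ u := ⟨hcount, fun b hb =>
        ⟨(huF hb).1, (huF hb).2.1, by have := (huF hb).2.1; have := (huF hb).2.2.1; linarith⟩,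
        hdisj⟩
      have hSu : S ⊆ ⋃ b ∈ u, Metric.closedBall b.1 (5 * b.2) := by
        rintro x ⟨-, hxB, hx⟩
        obtain ⟨k, hk, hk'⟩ := (hx.and_eventually (hρ.eventually_lt_const hη)).exists
        have hb : (x, ρ k / 5) ∈ F := by
          refine ⟨hxB, by have := hpos k; positivity, ?_, ?_⟩ <;> dsimp only <;>
            rw [mul_div_cancel₀ _ (by norm_num)]
          exacts [hk'.le, hk]
        obtain ⟨b, hbu, hbs⟩ := hcov _ hb
        exact Set.mem_biUnion hbu (hbs (Metric.mem_closedBall_self hb.2.1.le))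
      calc μ S ≤ ∑' b : u, μ (Metric.closedBall b.1.1 (5 * b.1.2)) :=
            (measure_mono hSu).trans (measure_biUnion_le _ hcount _)
        _ ≤ ∑' b : u, ENNReal.ofReal η ^ ((t : ℝ) - s) *
              (5 ^ (s : ℝ) * ENNReal.ofReal (2 * b.1.2) ^ (s : ℝ)) := by
          refine ENNReal.tsum_le_tsum fun b => (huF b.2).2.2.2.trans ?_
          have hb := (huF b.2).2.1
          have h5 : ENNReal.ofReal (5 * b.1.2) ≠ 0 := by
            simpa using hb
          have : (t : ℝ) = (t - s) + s := by ring
          rw [this, ENNReal.rpow_add _ _ h5 ENNReal.ofReal_ne_top, ← this]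
          gcongr
          · exact (huF b.2).2.2.1
          · rw [← ENNReal.mul_rpow_of_nonneg _ _ s.coe_nonneg]
            gcongr
            rw [← ENNReal.ofReal_ofNat, ← ENNReal.ofReal_mul (by norm_num)]
            exact ENNReal.ofReal_le_ofReal (by linarith)
        _ = ENNReal.ofReal η ^ ((t : ℝ) - s) *
              (5 ^ (s : ℝ) * ∑' b : u, ENNReal.ofReal (2 * b.1.2) ^ (s : ℝ)) := by
          rw [ENNReal.tsum_mul_left, ENNReal.tsum_mul_left]
        _ ≤ _ := by
          gcongr
          exact le_iSup₂_of_le u hpack le_rfl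
    by_contra hne
    have hC : 5 ^ (s : ℝ) * packingPreAt s δ (B i) ≠ ∞ :=
      ENNReal.mul_ne_top (ENNReal.rpow_ne_top_of_nonneg s.2 (by norm_num)) hne
    have hlim : Tendsto (fun η : ℝ => ENNReal.ofReal η ^ ((t : ℝ) - s) *
        (5 ^ (s : ℝ) * packingPreAt s δ (B i))) (𝓝[>] 0) (𝓝 0) := by
      have h1 : Tendsto (fun η : ℝ => ENNReal.ofReal η ^ ((t : ℝ) - s)) (𝓝[>] 0) (𝓝 0) := by
        have := (ENNReal.continuous_rpow_const (y := (t : ℝ) - s)).comp ENNReal.continuous_ofReal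
        have h2 : Tendsto (fun η : ℝ => ENNReal.ofReal η ^ ((t : ℝ) - s)) (𝓝[>] 0)
            (𝓝 (ENNReal.ofReal 0 ^ ((t : ℝ) - s))) :=
          (this.tendsto 0).mono_left nhdsWithin_le_nhds
        rwa [ENNReal.ofReal_zero, ENNReal.zero_rpow_of_pos (sub_pos.2 hst)] at h2
      simpa using ENNReal.Tendsto.mul_const h1 (Or.inr hC)
    have hle : μ S ≤ 0 := by
      refine ge_of_tendsto hlim ?_
      filter_upwards [Ioc_mem_nhdsGT hδ] with η hη
      exact bound η hη.1 hη.2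
    exact hi (le_antisymm hle zero_le)
  exact ENNReal.tsum_eq_top_of_eq_top ⟨i, hpre⟩

variable [BorelSpace X]

/-- Mass distribution principle along a sequence of scales. -/
theorem le_hausdorffDimMeasure (hμ : μ ≠ 0) {ρ : ℕ → ℝ} (hρ : Tendsto ρ atTop (𝓝 0))
    (hpos : ∀ k, 0 < ρ k) (t : ℝ≥0)
    (h : ∀ᵐ x ∂μ, ∀ᶠ k in atTop,
      μ (Metric.closedBall x (ρ k)) ≤ ENNReal.ofReal (ρ (k + 1)) ^ (t : ℝ)) :
    (t : ℝ≥0∞) ≤ hausdorffDimMeasure μ := by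
  refine le_iInf₂ fun A hA => ?_
  obtain ⟨K, hK⟩ := exists_measure_inter_ne_zero hA hμ h
    (B := fun K => {x | ∀ k, K ≤ k →
      μ (Metric.closedBall x (ρ k)) ≤ ENNReal.ofReal (ρ (k + 1)) ^ (t : ℝ)})
    (fun x _ hx => eventually_atTop.1 hx)
  set S := A ∩ {x | ∀ k, K ≤ k →
      μ (Metric.closedBall x (ρ k)) ≤ ENNReal.ofReal (ρ (k + 1)) ^ (t : ℝ)} with hS
  have piece : ∀ T : Set X, Metric.ediam T ≤ ENNReal.ofReal (ρ K) →
      μ (S ∩ T) ≤ ⨆ _ : T.Nonempty, Metric.ediam T ^ (t : ℝ) := by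
    intro T hT
    rcases (S ∩ T).eq_empty_or_nonempty with h0 | ⟨x, hxS, hxT⟩
    · simp [h0]
    rw [iSup_pos ⟨x, hxT⟩]
    have hfin : Metric.ediam T ≠ ∞ := ne_top_of_le_ne_top ENNReal.ofReal_ne_top hT
    have hsub : S ∩ T ⊆ Metric.closedBall x (Metric.ediam T).toReal := by
      intro y hy
      rw [Metric.mem_closedBall, dist_edist]
      exact ENNReal.toReal_mono hfin (Metric.edist_le_ediam_of_mem hy.2 hxT)
    -- A set of diameter zero matches no scale, so `k → ∞` is used instead; this also respects `0 ^
    -- 0 = 1` when `t = 0`.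
    rcases (ENNReal.toReal_nonneg (a := Metric.ediam T)).eq_or_lt with hd | hd
    · rw [← hd] at hsub
      have hlim : Tendsto (fun k => ENNReal.ofReal (ρ (k + 1)) ^ (t : ℝ)) atTop
          (𝓝 (Metric.ediam T ^ (t : ℝ))) := by
        have h0 : Metric.ediam T = ENNReal.ofReal 0 := by
          rw [← ENNReal.ofReal_toReal hfin, ← hd]
        rw [h0]
        exact (ENNReal.continuous_rpow_const.tendsto _).comp
          (ENNReal.tendsto_ofReal ((tendsto_add_atTop_iff_nat 1).2 hρ))
      refine ge_of_tendsto hlim (eventually_atTop.2 ⟨K, fun k hk => ?_⟩)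
      exact (measure_mono (hsub.trans (Metric.closedBall_subset_closedBall (hpos k).le))).trans
        (hxS.2 k hk)
    · have hd' : (Metric.ediam T).toReal ≤ ρ K := by
        have := ENNReal.toReal_mono ENNReal.ofReal_ne_top hT
        rwa [ENNReal.toReal_ofReal (hpos K).le] at this
      obtain ⟨k, hk, h1, h2⟩ := exists_scale_of_tendsto_zero hρ hd hd'
      calc μ (S ∩ T) ≤ μ (Metric.closedBall x (ρ k)) :=
            measure_mono (hsub.trans (Metric.closedBall_subset_closedBall h1))
        _ ≤ _ := hxS.2 k hk
        _ ≤ _ := by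
          gcongr
          rw [← ENNReal.ofReal_toReal hfin]
          exact ENNReal.ofReal_le_ofReal h2.le
  have key : μ S ≤ μH[t] S := by
    rw [Measure.hausdorffMeasure_apply]
    refine le_trans ?_ (le_iSup₂ (ENNReal.ofReal (ρ K)) (ENNReal.ofReal_pos.2 (hpos K)))
    refine le_iInf fun T => le_iInf fun hT => le_iInf fun hT' => ?_
    calc μ S ≤ μ (⋃ n, S ∩ T n) := by
          refine measure_mono ?_
          rw [← Set.inter_iUnion]
          exact Set.subset_inter subset_rfl hT
      _ ≤ ∑' n, μ (S ∩ T n) := measure_iUnion_le _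
      _ ≤ _ := ENNReal.tsum_le_tsum fun n => piece _ (hT' n)
  have hne : μH[t] S ≠ 0 := fun h0 => hK (le_antisymm (h0 ▸ key) zero_le)
  exact (le_dimH_of_hausdorffMeasure_ne_zero hne).trans (dimH_mono Set.inter_subset_left)

theorem tsum_measure_closedBall_le [SecondCountableTopology X] {u : Set (X × ℝ)}
    (hu : u.Countable) (hdisj : u.PairwiseDisjoint fun b => Metric.closedBall b.1 b.2) :
    ∑' b : u, μ (Metric.closedBall b.1.1 b.1.2) ≤ μ Set.univ := by
  rw [← measure_biUnion hu hdisj fun b _ => Metric.isClosed_closedBall.measurableSet]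
  exact measure_mono (Set.subset_univ _)

/-- If `μ` has lower local dimension at most `t` almost everywhere, then so is its Hausdorff
dimension. -/
theorem hausdorffDimMeasure_le [SecondCountableTopology X] [IsFiniteMeasure μ] {ρ : ℕ → ℝ}
    (hρ : Tendsto ρ atTop (𝓝 0)) (hpos : ∀ k, 0 < ρ k) (t : ℝ≥0)
    (h : ∀ᵐ x ∂μ, ∃ᶠ k in atTop,
      ENNReal.ofReal (ρ k) ^ (t : ℝ) ≤ μ (Metric.closedBall x (ρ k))) :
    hausdorffDimMeasure μ ≤ t := by
  set G := {x | ∃ᶠ k in atTop, ENNReal.ofReal (ρ k) ^ (t : ℝ) ≤ μ (Metric.closedBall x (ρ k))}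
    with hG
  refine iInf₂_le_of_le G (ae_iff.1 h) (dimH_le_of_hausdorffMeasure_ne_top ?_)
  -- The selected balls are disjoint, so the sum of `r ^ t` is at most the total mass; enlarging
  -- them to a cover only costs the constant `10 ^ t`.
  have cover : ∀ n : ℕ, ∃ u : Set (X × ℝ), u.Countable ∧
      (∀ b ∈ u, 0 < b.2 ∧ b.2 ≤ 1 / ((n : ℝ) + 1) ∧
        ENNReal.ofReal b.2 ^ (t : ℝ) ≤ μ (Metric.closedBall b.1 b.2)) ∧
      (u.PairwiseDisjoint fun b => Metric.closedBall b.1 b.2) ∧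
      G ⊆ ⋃ b : u, Metric.closedBall b.1.1 (5 * b.1.2) := by
    intro n
    set F : Set (X × ℝ) := {b | 0 < b.2 ∧ b.2 ≤ 1 / ((n : ℝ) + 1) ∧
        ENNReal.ofReal b.2 ^ (t : ℝ) ≤ μ (Metric.closedBall b.1 b.2)} with hF
    obtain ⟨u, huF, hdisj, hcov⟩ :=
      Vitali.exists_disjoint_subfamily_covering_enlargement_closedBall F (fun b => b.1)
        (fun b => b.2) (1 / ((n : ℝ) + 1)) (fun b hb => hb.2.1) 5 (by norm_num)
    refine ⟨u, hdisj.countable_of_nonempty_interior fun b hb =>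
      ⟨b.1, Metric.ball_subset_interior_closedBall (Metric.mem_ball_self (huF hb).1)⟩,
      fun b hb => huF hb, hdisj, fun x hx => ?_⟩
    have hn : (0 : ℝ) < 1 / ((n : ℝ) + 1) := by positivity
    obtain ⟨k, hk, hk'⟩ := (Frequently.and_eventually hx (hρ.eventually_lt_const hn)).exists
    obtain ⟨b, hbu, hbs⟩ := hcov (x, ρ k) ⟨hpos k, hk'.le, hk⟩
    exact Set.mem_iUnion.2 ⟨⟨b, hbu⟩, hbs (Metric.mem_closedBall_self (hpos k).le)⟩
  choose u hucount hu hudisj hucov using cover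
  have hcountable : ∀ n, Countable (u n) := fun n => (hucount n).to_subtype
  have hdiam : ∀ n, ∀ b : u n, Metric.ediam (Metric.closedBall b.1.1 (5 * b.1.2)) ≤
      ENNReal.ofReal (10 * b.1.2) := by
    intro n b
    refine Metric.ediam_le fun y hy z hz => ?_
    rw [edist_dist]
    refine ENNReal.ofReal_le_ofReal ?_
    have h1 := dist_triangle_right y z b.1.1
    rw [Metric.mem_closedBall] at hy hz
    linarith
  have hlim : Tendsto (fun n : ℕ => ENNReal.ofReal (10 * (1 / ((n : ℝ) + 1)))) atTop (𝓝 0) := by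
    have := (tendsto_one_div_add_atTop_nhds_zero_nat (𝕜 := ℝ)).const_mul 10
    simpa using ENNReal.tendsto_ofReal this
  have hle := Measure.hausdorffMeasure_le_liminf_tsum (t : ℝ) G _ hlim
    (fun n (b : u n) => Metric.closedBall b.1.1 (5 * b.1.2))
    (Eventually.of_forall fun n b => (hdiam n b).trans (ENNReal.ofReal_le_ofReal
      (by have := (hu n b b.2).2.1; linarith)))
    (Eventually.of_forall fun n => hucov n)
  have hsum : ∀ n, ∑' b : u n, Metric.ediam (Metric.closedBall b.1.1 (5 * b.1.2)) ^ (t : ℝ) ≤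
      10 ^ (t : ℝ) * μ Set.univ := by
    intro n
    calc _ ≤ ∑' b : u n, 10 ^ (t : ℝ) * μ (Metric.closedBall b.1.1 b.1.2) := by
          refine ENNReal.tsum_le_tsum fun b => ?_
          calc _ ≤ ENNReal.ofReal (10 * b.1.2) ^ (t : ℝ) := by gcongr; exact hdiam n b
            _ = 10 ^ (t : ℝ) * ENNReal.ofReal b.1.2 ^ (t : ℝ) := by
              rw [ENNReal.ofReal_mul (by norm_num), ENNReal.mul_rpow_of_nonneg _ _ t.coe_nonneg,
                ENNReal.ofReal_ofNat]
            _ ≤ _ := by gcongr; exact (hu n b b.2).2.2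
      _ ≤ _ := by
        rw [ENNReal.tsum_mul_left]
        gcongr
        exact tsum_measure_closedBall_le (hucount n) (hudisj n)
  refine ne_top_of_le_ne_top (ENNReal.mul_ne_top
    (ENNReal.rpow_ne_top_of_nonneg t.2 (by norm_num : (10 : ℝ≥0∞) ≠ ∞)) (measure_ne_top μ Set.univ))
    (hle.trans ?_)
  exact (liminf_le_liminf (Eventually.of_forall hsum)).trans (liminf_const _).le

/-- If `μ` has upper local dimension at most `t` almost everywhere, then so is its packing
dimension. -/
theorem packingDimMeasure_le [SecondCountableTopology X] [IsFiniteMeasure μ] {ρ : ℕ → ℝ}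
    (hρ : Tendsto ρ atTop (𝓝 0)) (hpos : ∀ k, 0 < ρ k) {C : ℝ}
    (hC : ∀ k, ρ k ≤ C * ρ (k + 1)) (t : ℝ≥0)
    (h : ∀ᵐ x ∂μ, ∀ᶠ k in atTop,
      ENNReal.ofReal (ρ k) ^ (t : ℝ) ≤ μ (Metric.closedBall x (ρ k))) :
    packingDimMeasure μ ≤ t := by
  have hC0 : 0 < C := by
    have := (hpos 0).trans_le (hC 0)
    exact pos_of_mul_pos_left this (hpos 1).le
  set G : ℕ → Set X := fun K => {x | ∀ k, K ≤ k →
    ENNReal.ofReal (ρ k) ^ (t : ℝ) ≤ μ (Metric.closedBall x (ρ k))} with hG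
  refine iInf₂_le_of_le (⋃ K, G K) ?_ ?_
  · refine measure_mono_null (fun x hx => ?_) (ae_iff.1 h)
    intro hx'
    obtain ⟨K, hK⟩ := eventually_atTop.1 hx'
    exact hx (Set.mem_iUnion.2 ⟨K, hK⟩)
  refine iSup₂_le fun s hs => ?_
  by_contra hts
  have hst : (t : ℝ) < s := by rw [not_le] at hts; exact_mod_cast hts
  have zero : ∀ K, packingPre s (G K) = 0 := by
    intro K
    -- A packing ball with radius `r` between `ρ (k + 1)` and `ρ k ≤ C ρ (k + 1)` has measure at
    -- least `(r / C) ^ t`. Disjointness bounds the sum of these by the total mass, and the spare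
    -- power `δ ^ (s - t)` tends to zero.
    have bound : ∀ δ : ℝ, 0 < δ → δ ≤ ρ K → packingPre s (G K) ≤
        ENNReal.ofReal (2 * δ) ^ ((s : ℝ) - t) *
          (ENNReal.ofReal (2 * C) ^ (t : ℝ) * μ Set.univ) := by
      intro δ hδ hδK
      refine iInf₂_le_of_le δ hδ (iSup₂_le fun T hT => ?_)
      obtain ⟨hcount, hT1, hdisj⟩ := hT
      calc _ ≤ ∑' b : T, ENNReal.ofReal (2 * δ) ^ ((s : ℝ) - t) *
              (ENNReal.ofReal (2 * C) ^ (t : ℝ) * μ (Metric.closedBall b.1.1 b.1.2)) := by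
            refine ENNReal.tsum_le_tsum fun b => ?_
            obtain ⟨hb1, hb2, hb3⟩ := hT1 b b.2
            obtain ⟨k, hk, hk1, hk2⟩ := exists_scale_of_tendsto_zero hρ hb2 (hb3.trans hδK)
            have h2 : ENNReal.ofReal (2 * b.1.2) ≠ 0 := by simpa using hb2
            have : (s : ℝ) = (s - t) + t := by ring
            rw [this, ENNReal.rpow_add _ _ h2 ENNReal.ofReal_ne_top, ← this]
            gcongr
            calc ENNReal.ofReal (2 * b.1.2) ^ (t : ℝ)
                ≤ ENNReal.ofReal (2 * C * ρ (k + 1)) ^ (t : ℝ) := by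
                  have := hC k
                  exact ENNReal.rpow_le_rpow (ENNReal.ofReal_le_ofReal (by linarith))
                    t.coe_nonneg
              _ = ENNReal.ofReal (2 * C) ^ (t : ℝ) * ENNReal.ofReal (ρ (k + 1)) ^ (t : ℝ) := by
                  rw [ENNReal.ofReal_mul (by positivity), ENNReal.mul_rpow_of_nonneg _ _ t.coe_nonneg]
              _ ≤ _ := by
                  gcongr
                  exact (hb1 (k + 1) (by omega)).trans
                    (measure_mono (Metric.closedBall_subset_closedBall hk2.le))
        _ ≤ _ := by
          rw [ENNReal.tsum_mul_left, ENNReal.tsum_mul_left]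
          gcongr
          exact tsum_measure_closedBall_le hcount hdisj
    have hfin : ENNReal.ofReal (2 * C) ^ (t : ℝ) * μ Set.univ ≠ ∞ :=
      ENNReal.mul_ne_top (ENNReal.rpow_ne_top_of_nonneg t.2 ENNReal.ofReal_ne_top)
        (measure_ne_top μ _)
    have hlim : Tendsto (fun δ : ℝ => ENNReal.ofReal (2 * δ) ^ ((s : ℝ) - t) *
        (ENNReal.ofReal (2 * C) ^ (t : ℝ) * μ Set.univ)) (𝓝[>] 0) (𝓝 0) := by
      have h1 : Tendsto (fun δ : ℝ => ENNReal.ofReal (2 * δ) ^ ((s : ℝ) - t)) (𝓝[>] 0) (𝓝 0) := by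
        have := (ENNReal.continuous_rpow_const (y := (s : ℝ) - t)).comp
          (ENNReal.continuous_ofReal.comp (continuous_const_mul (2 : ℝ)))
        have h2 : Tendsto (fun δ : ℝ => ENNReal.ofReal (2 * δ) ^ ((s : ℝ) - t)) (𝓝[>] 0)
            (𝓝 (ENNReal.ofReal (2 * 0) ^ ((s : ℝ) - t))) :=
          (this.tendsto 0).mono_left nhdsWithin_le_nhds
        rwa [mul_zero, ENNReal.ofReal_zero, ENNReal.zero_rpow_of_pos (sub_pos.2 hst)] at h2
      have := ENNReal.Tendsto.mul_const h1 (Or.inr hfin)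
      rwa [zero_mul] at this
    refine le_antisymm (ge_of_tendsto hlim ?_) zero_le
    filter_upwards [Ioc_mem_nhdsGT (hpos K)] with δ hδ
    exact bound δ hδ.1 hδ.2
  have : packingMeas s (⋃ K, G K) ≤ 0 := iInf₂_le_of_le G subset_rfl (by simp [zero])
  rw [hs] at this
  simp at this

end LocalDimension

theorem measurable_measure_closedBall {X : Type*} [MetricSpace X] [SecondCountableTopology X]
    [MeasurableSpace X] [BorelSpace X] (μ : Measure X) [SFinite μ] (r : ℝ) :
    Measurable fun x => μ (Metric.closedBall x r) := by
  have hs : MeasurableSet {z : X × X | dist z.2 z.1 ≤ r} :=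
    (isClosed_le (by fun_prop) continuous_const).measurableSet
  exact measurable_measure_prodMk_left hs

/-! ### A strong law of large numbers for non-identically distributed variables. -/

section LawOfLargeNumbers

open ProbabilityTheory

variable {Ω : Type*} [MeasurableSpace Ω] {μ : Measure Ω} [IsProbabilityMeasure μ]

/-- Both sums are monotone in `n`, and between consecutive squares the sum of means grows by at most
`(2j + 1) C = O(√n)`. Control along squares therefore suffices. -/
theorem abs_sum_sub_le_of_squares {y e : ℕ → ℝ} (hy : ∀ i, 0 ≤ y i) (he : ∀ i, 0 ≤ e i) {C ε : ℝ}
    (hε : 0 < ε) (heC : ∀ i, e i ≤ C)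
    (h : ∀ᶠ j : ℕ in atTop, |∑ i ∈ Finset.range (j ^ 2), y i - ∑ i ∈ Finset.range (j ^ 2), e i| ≤
      ε / 8 * (j : ℝ) ^ 2) :
    ∀ᶠ n : ℕ in atTop, |∑ i ∈ Finset.range n, y i - ∑ i ∈ Finset.range n, e i| ≤ ε * n := by
  have hC : 0 ≤ C := (he 0).trans (heC 0)
  obtain ⟨J, hJ⟩ := eventually_atTop.1 h
  have hmono : ∀ {z : ℕ → ℝ}, (∀ i, 0 ≤ z i) → Monotone fun n => ∑ i ∈ Finset.range n, z i :=
    fun hz a b hab => Finset.sum_le_sum_of_subset_of_nonneg (Finset.range_mono hab)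
      fun i _ _ => hz i
  have hsqrt : Tendsto Nat.sqrt atTop atTop := by
    refine tendsto_atTop.2 fun b => ?_
    filter_upwards [eventually_ge_atTop (b * b)] with n hn
    exact Nat.le_sqrt.2 hn
  filter_upwards [hsqrt.eventually_ge_atTop J, hsqrt.eventually_ge_atTop 1,
    hsqrt.eventually_ge_atTop ⌈6 * C / ε⌉₊] with n h1 h2 h3
  set j := n.sqrt with hj
  have hjn : j ^ 2 ≤ n := Nat.sqrt_le' n
  have hnj : n ≤ (j + 1) ^ 2 := (Nat.lt_succ_sqrt' n).le
  have hgap : ∑ i ∈ Finset.range ((j + 1) ^ 2), e i ≤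
      ∑ i ∈ Finset.range (j ^ 2), e i + (2 * j + 1) * C := by
    have hle : j ^ 2 ≤ (j + 1) ^ 2 := by gcongr; omega
    rw [← Finset.sum_range_add_sum_Ico _ hle]
    gcongr
    calc ∑ i ∈ Finset.Ico (j ^ 2) ((j + 1) ^ 2), e i
        ≤ ∑ i ∈ Finset.Ico (j ^ 2) ((j + 1) ^ 2), C := Finset.sum_le_sum fun i _ => heC i
      _ = (2 * j + 1) * C := by
        rw [Finset.sum_const, Nat.card_Ico, nsmul_eq_mul]
        have : (j + 1) ^ 2 - j ^ 2 = 2 * j + 1 := by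
          rw [Nat.sub_eq_iff_eq_add hle]; ring
        rw [this]; push_cast; ring
  have hj1 : (1 : ℝ) ≤ j := by exact_mod_cast h2
  have hjC : 6 * C ≤ ε * j := by
    have := (Nat.le_ceil _).trans (Nat.cast_le (α := ℝ).2 h3)
    rw [div_le_iff₀ hε] at this
    linarith
  have hjn' : (j : ℝ) ^ 2 ≤ n := by exact_mod_cast hjn
  have ha := abs_le.1 (hJ j h1)
  have hb := abs_le.1 (hJ (j + 1) (by omega))
  have y1 := hmono hy hjn
  have y2 := hmono hy hnj
  have e1 := hmono he hjn
  have e2 := hmono he hnj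
  push_cast at *
  -- The budget `ε` splits in halves: `2j + 1 ≤ 3j` with `6C ≤ εj` handles the gap, and `(j + 1)² ≤
  -- 4j²` turns `ε / 8` into `ε / 2`.
  have k1 : (2 * (j : ℝ) + 1) * C ≤ ε / 2 * (j : ℝ) ^ 2 := by nlinarith
  have k2 : ε / 8 * ((j : ℝ) + 1) ^ 2 ≤ ε / 2 * (j : ℝ) ^ 2 := by nlinarith
  have k3 : ε * (j : ℝ) ^ 2 ≤ ε * n := by gcongr
  have k4 : 0 ≤ ε * (j : ℝ) ^ 2 := by positivity
  rw [abs_le]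
  constructor <;> linarith [hb.2, ha.1]

/-- Strong law of large numbers for nonnegative independent variables with bounded second
moments. -/
theorem ae_eventually_abs_sum_sub_le {Y : ℕ → Ω → ℝ} (hmem : ∀ i, MemLp (Y i) 2 μ)
    (hindep : Pairwise fun i j => IndepFun (Y i) (Y j) μ) (hY : ∀ i ω, 0 ≤ Y i ω) {C : ℝ}
    (hC : ∀ i, ∫ ω, Y i ω ^ 2 ∂μ ≤ C) {ε : ℝ} (hε : 0 < ε) :
    ∀ᵐ ω ∂μ, ∀ᶠ n : ℕ in atTop,
      |∑ i ∈ Finset.range n, Y i ω - ∑ i ∈ Finset.range n, ∫ ω, Y i ω ∂μ| ≤ ε * n := by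
  have hint : ∀ i, Integrable (Y i) μ := fun i => (hmem i).integrable (by norm_num)
  have hE : ∀ i, ∫ ω, Y i ω ∂μ ≤ C + 1 := by
    intro i
    calc ∫ ω, Y i ω ∂μ ≤ ∫ ω, (Y i ω ^ 2 + 1) ∂μ :=
          integral_mono (hint i) ((hmem i).integrable_sq.add (integrable_const _))
            fun ω => by nlinarith [sq_nonneg (Y i ω - 1), hY i ω]
      _ = ∫ ω, Y i ω ^ 2 ∂μ + 1 := by
        rw [integral_add (hmem i).integrable_sq (integrable_const _)]; simp
      _ ≤ C + 1 := by linarith [hC i]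
  have hvar : ∀ n : ℕ, variance (∑ i ∈ Finset.range n, Y i) μ ≤ n * C := by
    intro n
    rw [IndepFun.variance_sum (fun i _ => hmem i) (fun i _ j _ hij => hindep hij)]
    calc _ ≤ ∑ i ∈ Finset.range n, C := Finset.sum_le_sum fun i _ =>
          (variance_le_expectation_sq (hmem i).1).trans (hC i)
      _ = n * C := by simp
  -- Chebyshev at time `j²` gives probability `O(1 / j²)`, which is summable, so Borel–Cantelli
  -- applies. The shift to `j + 1` avoids division by zero.
  set A : ℕ → Set Ω := fun j => {ω | ε / 8 * ((j + 1 : ℕ) : ℝ) ^ 2 ≤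
    |∑ i ∈ Finset.range ((j + 1) ^ 2), Y i ω - ∑ i ∈ Finset.range ((j + 1) ^ 2), ∫ ω, Y i ω ∂μ|}
  have hA : ∀ j, μ (A j) ≤ ENNReal.ofReal (64 * C / ε ^ 2 * (1 / ((j + 1 : ℕ) : ℝ) ^ 2)) := by
    intro j
    have hj : (0 : ℝ) < ((j + 1 : ℕ) : ℝ) := by positivity
    have hT : MemLp (∑ i ∈ Finset.range ((j + 1) ^ 2), Y i) 2 μ :=
      memLp_finsetSum' _ fun i _ => hmem i
    have hcheb := meas_ge_le_variance_div_sq hT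
      (c := ε / 8 * ((j + 1 : ℕ) : ℝ) ^ 2) (by positivity)
    have hmean : ∫ ω, (∑ i ∈ Finset.range ((j + 1) ^ 2), Y i) ω ∂μ =
        ∑ i ∈ Finset.range ((j + 1) ^ 2), ∫ ω, Y i ω ∂μ := by
      simp_rw [Finset.sum_apply]
      exact integral_finsetSum _ fun i _ => hint i
    rw [hmean] at hcheb
    simp only [Finset.sum_apply] at hcheb
    refine hcheb.trans (ENNReal.ofReal_le_ofReal ?_)
    have hv := hvar ((j + 1) ^ 2)
    rw [div_le_iff₀ (by positivity)]
    refine hv.trans (le_of_eq ?_)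
    rw [Nat.cast_pow]
    field_simp
    ring
  have hsum : ∑' j, μ (A j) ≠ ∞ := by
    refine ne_top_of_le_ne_top ?_ (ENNReal.tsum_le_tsum hA)
    refine Summable.tsum_ofReal_ne_top (Summable.mul_left _ ?_)
    exact (summable_nat_add_iff 1).2 (Real.summable_one_div_nat_pow.2 (by norm_num : 1 < 2))
  filter_upwards [ae_eventually_notMem hsum] with ω hω
  refine abs_sum_sub_le_of_squares (fun i => hY i ω) (fun i => integral_nonneg (hY i)) hε hE ?_
  obtain ⟨J, hJ⟩ := eventually_atTop.1 hω
  refine eventually_atTop.2 ⟨J + 1, fun j hj => ?_⟩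
  obtain ⟨j, rfl⟩ : ∃ i, j = i + 1 := ⟨j - 1, by omega⟩
  have := hJ j (by omega)
  simp only [A, Set.mem_ofPred_eq, not_le] at this
  exact this.le

end LawOfLargeNumbers

namespace MoranData

open ProbabilityTheory

variable (S : MoranData) (p : S.ProbSeq)

instance : IsProbabilityMeasure (S.seqMeasure p) := by
  unfold seqMeasure; infer_instance

theorem levelMeasure_apply (k : ℕ) (A : Set (S.D k)) [DecidablePred (· ∈ A)] :
    S.levelMeasure p k A = ENNReal.ofReal (∑ w : S.D k, if w ∈ A then (p k).1 w else 0) := by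
  rw [ENNReal.ofReal_sum_of_nonneg]
  · simp only [levelMeasure, Measure.coe_finsetSum, Finset.sum_apply, Measure.smul_apply,
      smul_eq_mul]
    refine Finset.sum_congr rfl fun w _ => ?_
    rw [Measure.dirac_apply' _ (by measurability)]
    by_cases h : w ∈ A <;> simp [h]
  · intro w _
    split_ifs
    exacts [(p k).2.1 w, le_rfl]

theorem integral_levelMeasure (k : ℕ) (f : S.D k → ℝ) :
    ∫ w, f w ∂(S.levelMeasure p k) = ∑ w : S.D k, (p k).1 w * f w := by
  rw [integral_fintype (by exact Integrable.of_finite)]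
  refine Finset.sum_congr rfl fun w _ => ?_
  classical
  rw [Measure.real, levelMeasure_apply, smul_eq_mul]
  simp [ENNReal.toReal_ofReal ((p k).2.1 w)]

theorem integral_seqMeasure (k : ℕ) (f : S.D k → ℝ) :
    ∫ w, f (w k) ∂(S.seqMeasure p) = ∑ w : S.D k, (p k).1 w * f w := by
  have hmp : MeasurePreserving (Function.eval k) (S.seqMeasure p) (S.levelMeasure p k) :=
    measurePreserving_eval_infinitePi _ _
  rw [← integral_levelMeasure, ← hmp.map_eq, integral_map hmp.measurable.aemeasurable
    (by exact (measurable_of_finite f).aestronglyMeasurable)]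

theorem ae_eventually_abs_sum_sub_le_seqMeasure {f : ∀ i, S.D i → ℝ} (hf : ∀ i w, 0 ≤ f i w) {C : ℝ}
    (hC : ∀ i, ∑ w : S.D i, (p i).1 w * f i w ^ 2 ≤ C) {ε : ℝ} (hε : 0 < ε) :
    ∀ᵐ w ∂(S.seqMeasure p), ∀ᶠ n : ℕ in atTop,
      |∑ i ∈ Finset.range n, f i (w i) -
        ∑ i ∈ Finset.range n, ∑ w : S.D i, (p i).1 w * f i w| ≤ ε * n := by
  have hmeas : ∀ i, Measurable fun w : S.Seq => f i (w i) := fun i =>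
    (measurable_of_finite (f i)).comp (measurable_pi_apply i)
  have h := ae_eventually_abs_sum_sub_le (μ := S.seqMeasure p) (Y := fun i w => f i (w i)) (C := C)
    (fun i => by
      refine MemLp.of_bound (hmeas i).aestronglyMeasurable (∑ w : S.D i, f i w)
        (ae_of_all _ fun w => ?_)
      rw [Real.norm_of_nonneg (hf _ _)]
      exact Finset.single_le_sum (f := f i) (fun v _ => hf i v) (Finset.mem_univ _))
    (fun i j hij => (iIndepFun_infinitePi (P := S.levelMeasure p) (X := f)
      fun i => measurable_of_finite _).indepFun hij)
    (fun i w => hf i _)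
    (fun i => by rw [integral_seqMeasure S p i fun v => f i v ^ 2]; exact hC i) hε
  simpa only [integral_seqMeasure] using h

end MoranData

/-! ### Cantor series: digits and the position of a number in its cell. -/

section CantorSeries

/-- The length `(c_0 ⋯ c_{k-1})⁻¹` of the cells of order `k` of the Cantor series with bases `c`. -/
def cellLength (c : ℕ → ℕ) (k : ℕ) : ℝ := ∏ h ∈ Finset.range k, (c h : ℝ)⁻¹

/-- The number with digits `d` in the Cantor series with bases `c`. -/
def digitValue (c d : ℕ → ℕ) : ℝ := ∑' k, cellLength c (k + 1) * (d k : ℝ)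

/-- The truncation of `digitValue` to the first `k` digits. -/
def digitSum (c d : ℕ → ℕ) (k : ℕ) : ℝ := ∑ i ∈ Finset.range k, cellLength c (i + 1) * (d i : ℝ)

variable {c d d' : ℕ → ℕ}

theorem cellLength_pos (hc : ∀ k, 2 ≤ c k) (k : ℕ) : 0 < cellLength c k :=
  Finset.prod_pos fun h _ => by have := hc h; positivity

theorem cellLength_eq_mul (hc : ∀ k, 2 ≤ c k) (k : ℕ) :
    cellLength c k = cellLength c (k + 1) * c k := by
  have : (c k : ℝ) ≠ 0 := by have := hc k; positivity
  rw [cellLength, cellLength, Finset.prod_range_succ, mul_assoc, inv_mul_cancel₀ this, mul_one]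

theorem cellLength_antitone (hc : ∀ k, 2 ≤ c k) : Antitone (cellLength c) := by
  refine antitone_nat_of_succ_le fun k => ?_
  rw [cellLength_eq_mul hc k]
  refine le_mul_of_one_le_right (cellLength_pos hc _).le ?_
  exact_mod_cast (by decide : 1 ≤ 2).trans (hc k)

theorem digitSum_succ (k : ℕ) :
    digitSum c d (k + 1) = digitSum c d k + cellLength c (k + 1) * d k :=
  Finset.sum_range_succ _ _

theorem digitSum_congr {k : ℕ} (h : ∀ i < k, d i = d' i) : digitSum c d k = digitSum c d' k :=
  Finset.sum_congr rfl fun i hi => by rw [h i (Finset.mem_range.1 hi)]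

theorem digitSum_monotone (hc : ∀ k, 2 ≤ c k) : Monotone (digitSum c d) := by
  refine monotone_nat_of_le_succ fun k => ?_
  rw [digitSum_succ]
  have := cellLength_pos hc (k + 1)
  exact le_add_of_nonneg_right (by positivity)

theorem digitSum_add_cellLength_succ (hc : ∀ k, 2 ≤ c k) (k : ℕ) :
    digitSum c d (k + 1) + cellLength c (k + 1) =
      digitSum c d k + cellLength c k - cellLength c (k + 1) * (c k - 1 - d k) := by
  rw [digitSum_succ, cellLength_eq_mul hc k]
  ring

/-- Right endpoints of nested cells move left. -/
theorem digitSum_add_cellLength_antitone (hc : ∀ k, 2 ≤ c k) (hd : ∀ k, d k < c k) :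
    Antitone fun k => digitSum c d k + cellLength c k := by
  refine antitone_nat_of_succ_le fun k => ?_
  rw [digitSum_add_cellLength_succ hc]
  have h1 : (d k : ℝ) + 1 ≤ c k := by exact_mod_cast hd k
  have := cellLength_pos hc (k + 1)
  nlinarith

theorem tendsto_digitSum (hc : ∀ k, 2 ≤ c k) (hd : ∀ k, d k < c k) :
    Tendsto (digitSum c d) atTop (𝓝 (digitValue c d)) :=
  (MoranData.summable_digits hc hd).hasSum.tendsto_sum_nat

theorem digitSum_le_digitValue (hc : ∀ k, 2 ≤ c k) (hd : ∀ k, d k < c k) (k : ℕ) :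
    digitSum c d k ≤ digitValue c d :=
  ge_of_tendsto (tendsto_digitSum hc hd)
    (eventually_atTop.2 ⟨k, fun _ hj => digitSum_monotone hc hj⟩)

theorem digitValue_le (hc : ∀ k, 2 ≤ c k) (hd : ∀ k, d k < c k) (k : ℕ) :
    digitValue c d ≤ digitSum c d k + cellLength c k :=
  le_of_tendsto (tendsto_digitSum hc hd) (eventually_atTop.2 ⟨k, fun j hj =>
    (le_add_of_nonneg_right (cellLength_pos hc j).le).trans
      (digitSum_add_cellLength_antitone hc hd hj)⟩)

theorem abs_digitValue_sub_le (hc : ∀ k, 2 ≤ c k) (hd : ∀ k, d k < c k) (hd' : ∀ k, d' k < c k)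
    {k : ℕ} (h : ∀ i < k, d i = d' i) : |digitValue c d - digitValue c d'| ≤ cellLength c k := by
  have h1 := digitSum_le_digitValue hc hd k
  have h2 := digitSum_le_digitValue hc hd' k
  have h3 := digitValue_le hc hd k
  have h4 := digitValue_le hc hd' k
  rw [digitSum_congr h] at h1 h3
  rw [abs_le]
  constructor <;> linarith

/-- A nonzero digit `i` moves the number at least one cell of order `i + 1` away from the left
endpoint of its `k`-th cell. `digitValue_le_sub` is the mirror image. -/
theorem digitSum_add_le_digitValue (hc : ∀ k, 2 ≤ c k) (hd : ∀ k, d k < c k) {k s i : ℕ}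
    (hki : k ≤ i) (his : i < k + s) (hi : d i ≠ 0) :
    digitSum c d k + cellLength c (k + s) ≤ digitValue c d := by
  have h1 := digitSum_le_digitValue hc hd (i + 1)
  have h2 := digitSum_monotone (d := d) hc hki
  have h3 : cellLength c (k + s) ≤ cellLength c (i + 1) := cellLength_antitone hc (by omega)
  have h4 : (1 : ℝ) ≤ d i := by exact_mod_cast Nat.one_le_iff_ne_zero.2 hi
  have h5 := cellLength_pos hc (i + 1)
  rw [digitSum_succ] at h1
  nlinarith

theorem digitValue_le_sub (hc : ∀ k, 2 ≤ c k) (hd : ∀ k, d k < c k) {k s i : ℕ}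
    (hki : k ≤ i) (his : i < k + s) (hi : d i ≠ c i - 1) :
    digitValue c d ≤ digitSum c d k + cellLength c k - cellLength c (k + s) := by
  have h1 := digitValue_le hc hd (i + 1)
  have h2 := digitSum_add_cellLength_antitone hc hd hki
  have h3 : cellLength c (k + s) ≤ cellLength c (i + 1) := cellLength_antitone hc (by omega)
  have h4 : (d i : ℝ) + 2 ≤ c i := by
    have := hd i
    exact_mod_cast (by omega : d i + 2 ≤ c i)
  have h5 := cellLength_pos hc (i + 1)
  rw [digitSum_add_cellLength_succ hc] at h1
  dsimp only at h2
  nlinarith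

/-- The first differing digit decides on which side the other number lies. -/
theorem digitValue_outside_cell (hc : ∀ k, 2 ≤ c k) (hd : ∀ k, d k < c k) (hd' : ∀ k, d' k < c k)
    {k : ℕ} (h : ∃ i < k, d i ≠ d' i) :
    digitValue c d' ≤ digitSum c d k ∨ digitSum c d k + cellLength c k ≤ digitValue c d' := by
  classical
  obtain ⟨hik, hne⟩ := Nat.find_spec h
  set i := Nat.find h
  have heq : digitSum c d i = digitSum c d' i := digitSum_congr fun j hj => by
    by_contra hj'
    exact Nat.find_min h hj ⟨hj.trans hik, hj'⟩
  have hpos := cellLength_pos hc (i + 1)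
  rcases lt_or_gt_of_ne hne with hlt | hlt
  · right
    have h1 := digitSum_add_cellLength_antitone hc hd (Nat.succ_le_of_lt hik)
    have h2 := digitSum_le_digitValue hc hd' (i + 1)
    have h3 : (d i : ℝ) + 1 ≤ d' i := by exact_mod_cast hlt
    dsimp only [Nat.succ_eq_add_one] at h1
    rw [digitSum_succ] at h1 h2
    nlinarith
  · left
    have h1 := digitSum_monotone (d := d) hc (Nat.succ_le_of_lt hik)
    have h2 := digitValue_le hc hd' (i + 1)
    have h3 : (d' i : ℝ) + 1 ≤ d i := by exact_mod_cast hlt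
    rw [Nat.succ_eq_add_one] at h1
    rw [digitSum_succ] at h1 h2
    nlinarith

/-- A number whose first `k` digits differ lies outside the open `k`-th cell, while `d` stays
`cellLength c (k + s)` inside it on both sides. The strict inequality matters, since neighbouring
cells share endpoints. -/
theorem eq_of_abs_digitValue_sub_lt (hc : ∀ k, 2 ≤ c k) (hd : ∀ k, d k < c k)
    (hd' : ∀ k, d' k < c k) {k s : ℕ} (h0 : ∃ i, k ≤ i ∧ i < k + s ∧ d i ≠ 0)
    (h1 : ∃ i, k ≤ i ∧ i < k + s ∧ d i ≠ c i - 1)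
    (h : |digitValue c d - digitValue c d'| < cellLength c (k + s)) : ∀ i < k, d i = d' i := by
  by_contra! hne
  obtain ⟨i, hi, hi', hi0⟩ := h0
  obtain ⟨j, hj, hj', hj1⟩ := h1
  have k1 := digitSum_add_le_digitValue hc hd hi hi' hi0
  have k2 := digitValue_le_sub hc hd hj hj' hj1
  rw [abs_lt] at h
  rcases digitValue_outside_cell hc hd hd' hne with h | h <;> linarith

end CantorSeries

/-! ### Approximate squares in sequence space and their projections. -/

namespace MoranData

variable (S : MoranData)

theorem fst_lt (w : S.Seq) (k : ℕ) : (w k).1.1 < S.n k := by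
  have := S.D_subset k (w k).2
  simp at this
  exact this.1

theorem snd_lt (w : S.Seq) (k : ℕ) : (w k).1.2 < S.m k := by
  have := S.D_subset k (w k).2
  simp at this
  exact this.2

theorem proj_apply_zero (w : S.Seq) : S.proj w 0 = digitValue S.n fun k => (w k).1.1 := rfl

theorem proj_apply_one (w : S.Seq) : S.proj w 1 = digitValue S.m fun k => (w k).1.2 := rfl

/-- The sequences that share `a` first coordinates and `b` second coordinates with `w`. -/
def cell (a b : ℕ) (w : S.Seq) : Set S.Seq :=
  {v | (∀ i < a, (w i).1.1 = (v i).1.1) ∧ ∀ i < b, (w i).1.2 = (v i).1.2}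

theorem dist_proj_le {a b : ℕ} {w v : S.Seq} (hv : v ∈ S.cell a b w) :
    dist (S.proj v) (S.proj w) ≤ cellLength S.n a + cellLength S.m b := by
  rw [dist_comm, EuclideanSpace.dist_eq, Fin.sum_univ_two, Real.dist_eq, Real.dist_eq,
    proj_apply_zero, proj_apply_zero, proj_apply_one, proj_apply_one]
  have h1 := abs_digitValue_sub_le S.two_le_n (S.fst_lt w) (S.fst_lt v) hv.1
  have h2 := abs_digitValue_sub_le S.two_le_m (S.snd_lt w) (S.snd_lt v) hv.2
  refine le_trans (Real.sqrt_le_iff.2 ⟨by positivity, ?_⟩) (add_le_add h1 h2)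
  nlinarith [mul_nonneg (abs_nonneg (digitValue S.n (fun k => (w k).1.1) -
    digitValue S.n fun k => (v k).1.1)) (abs_nonneg (digitValue S.m (fun k => (w k).1.2) -
    digitValue S.m fun k => (v k).1.2))]

/-- The digits of `w` keep the point `S.proj w` away from the boundary of its cell. -/
def IsInner (a b s : ℕ) (w : S.Seq) : Prop :=
  (∃ i, a ≤ i ∧ i < a + s ∧ (w i).1.1 ≠ 0) ∧ (∃ i, a ≤ i ∧ i < a + s ∧ (w i).1.1 ≠ S.n i - 1) ∧
  (∃ i, b ≤ i ∧ i < b + s ∧ (w i).1.2 ≠ 0) ∧ (∃ i, b ≤ i ∧ i < b + s ∧ (w i).1.2 ≠ S.m i - 1)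

/-- Points near the projection of an inner sequence come from the same cell. -/
theorem mem_cell_of_dist_lt {a b s : ℕ} {w v : S.Seq} (hw : S.IsInner a b s w)
    (h1 : dist (S.proj v) (S.proj w) < cellLength S.n (a + s))
    (h2 : dist (S.proj v) (S.proj w) < cellLength S.m (b + s)) : v ∈ S.cell a b w := by
  have key : ∀ i, |S.proj w i - S.proj v i| ≤ dist (S.proj v) (S.proj w) := fun i => by
    rw [dist_comm, dist_eq_norm]
    exact PiLp.norm_apply_le (S.proj w - S.proj v) i
  exact ⟨eq_of_abs_digitValue_sub_lt S.two_le_n (S.fst_lt w) (S.fst_lt v) hw.1 hw.2.1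
      ((key 0).trans_lt h1),
    eq_of_abs_digitValue_sub_lt S.two_le_m (S.snd_lt w) (S.snd_lt v) hw.2.2.1 hw.2.2.2
      ((key 1).trans_lt h2)⟩

end MoranData

/-- Follows from `exp u ≥ u² / 2` at `u = -log y`. It bounds the second moments of the information
functions uniformly in the probability vectors. -/
theorem mul_neg_log_sq_le {x y : ℝ} (hx : 0 ≤ x) (hxy : x ≤ y) (hy : y ≤ 1) :
    x * (-Real.log y) ^ 2 ≤ 2 := by
  rcases (hx.trans hxy).eq_or_lt with h | h
  · rw [le_antisymm (h ▸ hxy) hx]; norm_num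
  have h1 := Real.pow_div_factorial_le_exp (-Real.log y)
    (neg_nonneg.2 (Real.log_nonpos h.le hy)) 2
  rw [Real.exp_neg, Real.exp_log h] at h1
  have h2 : (-Real.log y) ^ 2 ≤ 2 * y⁻¹ := by
    norm_num [Nat.factorial] at h1 ⊢
    linarith
  calc x * (-Real.log y) ^ 2 ≤ y * (2 * y⁻¹) := by gcongr
    _ = 2 := by field_simp

namespace MoranData

variable (S : MoranData) (p : S.ProbSeq)

/-! ### Comparability of `l(k)` with `k`, and of the two sides of an approximate square. -/

section Ell

theorem cellLength_eq_inv (c : ℕ → ℕ) (k : ℕ) :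
    cellLength c k = ((∏ h ∈ Finset.range k, c h : ℕ) : ℝ)⁻¹ := by
  rw [cellLength, Nat.cast_prod, Finset.prod_inv_distrib]

theorem two_pow_le_prod {c : ℕ → ℕ} (hc : ∀ k, 2 ≤ c k) (k : ℕ) :
    2 ^ k ≤ ∏ h ∈ Finset.range k, c h := by
  calc 2 ^ k = ∏ h ∈ Finset.range k, 2 := by simp
    _ ≤ _ := Finset.prod_le_prod' fun h _ => hc h

theorem prod_le_pow {c : ℕ → ℕ} {N : ℕ} (hc : ∀ k, c k ≤ N) (k : ℕ) :
    ∏ h ∈ Finset.range k, c h ≤ N ^ k := by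
  calc _ ≤ ∏ h ∈ Finset.range k, N := Finset.prod_le_prod' fun h _ => hc h
    _ = _ := by simp

theorem prod_le_prod_ell (k : ℕ) :
    ∏ h ∈ Finset.range k, S.m h ≤ ∏ h ∈ Finset.range (S.ell k), S.n h := by
  have : {l | ∏ h ∈ Finset.range k, S.m h ≤ ∏ h ∈ Finset.range l, S.n h}.Nonempty :=
    ⟨_, Nat.lt_two_pow_self.le.trans (two_pow_le_prod S.two_le_n _)⟩
  exact Nat.sInf_mem this

theorem prod_lt_of_lt_ell {k l : ℕ} (h : l < S.ell k) :
    ∏ h ∈ Finset.range l, S.n h < ∏ h ∈ Finset.range k, S.m h := by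
  by_contra! hle
  exact absurd (Nat.sInf_le (s := {l | _ ≤ _}) hle) (not_le.2 h)

theorem cellLength_ell_le (k : ℕ) : cellLength S.n (S.ell k) ≤ cellLength S.m k := by
  rw [cellLength_eq_inv, cellLength_eq_inv]
  refine inv_anti₀ ?_ (by exact_mod_cast S.prod_le_prod_ell k)
  exact_mod_cast (pow_pos two_pos k).trans_le (two_pow_le_prod S.two_le_m k)

variable {S} {N : ℕ}

theorem two_le_bound (hN : ∀ k, S.n k ≤ N ∧ S.m k ≤ N) : 2 ≤ N := (S.two_le_n 0).trans (hN 0).1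

/-- By minimality of `ell`, the column cell one level earlier is still at least `cellLength S.m k`
long, and one level costs at most a factor `N`. -/
theorem cellLength_le_ell (hN : ∀ k, S.n k ≤ N ∧ S.m k ≤ N) (k : ℕ) :
    cellLength S.m k ≤ N * cellLength S.n (S.ell k) := by
  have hN1 := two_le_bound hN
  rcases Nat.eq_zero_or_pos (S.ell k) with h | h
  · rw [h]
    have h1 : cellLength S.m k ≤ cellLength S.m 0 := cellLength_antitone S.two_le_m (Nat.zero_le k)
    have h2 : (1 : ℝ) ≤ N := by exact_mod_cast (by omega : 1 ≤ N)
    simp only [cellLength, Finset.range_zero, Finset.prod_empty, mul_one] at h1 ⊢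
    linarith
  · obtain ⟨l, hl⟩ : ∃ l, S.ell k = l + 1 := ⟨S.ell k - 1, by omega⟩
    have h1 := S.prod_lt_of_lt_ell (k := k) (l := l) (by omega)
    have h2 : cellLength S.m k ≤ cellLength S.n l := by
      rw [cellLength_eq_inv, cellLength_eq_inv]
      refine inv_anti₀ ?_ (by exact_mod_cast h1.le)
      exact_mod_cast (pow_pos two_pos l).trans_le (two_pow_le_prod S.two_le_n l)
    rw [hl]
    rw [cellLength_eq_mul S.two_le_n l, mul_comm] at h2
    refine h2.trans ?_
    have := cellLength_pos S.two_le_n (l + 1)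
    gcongr
    exact (hN l).1

theorem ell_le (hN : ∀ k, S.n k ≤ N ∧ S.m k ≤ N) (k : ℕ) : S.ell k ≤ N * k := by
  refine Nat.sInf_le ?_
  calc ∏ h ∈ Finset.range k, S.m h ≤ N ^ k := prod_le_pow (fun k => (hN k).2) k
    _ ≤ (2 ^ N) ^ k := Nat.pow_le_pow_left Nat.lt_two_pow_self.le k
    _ = 2 ^ (N * k) := (pow_mul _ _ _).symm
    _ ≤ _ := two_pow_le_prod S.two_le_n _

theorem le_ell (hN : ∀ k, S.n k ≤ N ∧ S.m k ≤ N) (k : ℕ) : k ≤ N * S.ell k := by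
  refine (Nat.pow_le_pow_iff_right (a := 2) (by norm_num)).1 ?_
  calc 2 ^ k ≤ ∏ h ∈ Finset.range k, S.m h := two_pow_le_prod S.two_le_m k
    _ ≤ _ := S.prod_le_prod_ell k
    _ ≤ N ^ S.ell k := prod_le_pow (fun k => (hN k).1) _
    _ ≤ (2 ^ N) ^ S.ell k := Nat.pow_le_pow_left Nat.lt_two_pow_self.le _
    _ = _ := (pow_mul _ _ _).symm

theorem tendsto_ell (hN : ∀ k, S.n k ≤ N ∧ S.m k ≤ N) : Tendsto S.ell atTop atTop := by
  refine tendsto_atTop.2 fun b => ?_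
  filter_upwards [eventually_gt_atTop (N * b)] with k hk
  have := hk.trans_le (le_ell hN k)
  exact (Nat.lt_of_mul_lt_mul_left this).le

end Ell

/-! ### Marginal probabilities and the law of large numbers for information. -/

section Marginals

theorem apply_le_rowProb (i : ℕ) (w : S.D i) : (p i).1 w ≤ S.rowProb p i w.1.2 := by
  have := Finset.single_le_sum (f := fun v : S.D i => if v.1.2 = w.1.2 then (p i).1 v else 0)
    (fun v _ => by split_ifs; exacts [(p i).2.1 v, le_rfl]) (Finset.mem_univ w)
  simpa [rowProb] using this

theorem apply_le_colProb (i : ℕ) (w : S.D i) : (p i).1 w ≤ S.colProb p i w.1.1 := by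
  have := Finset.single_le_sum (f := fun v : S.D i => if v.1.1 = w.1.1 then (p i).1 v else 0)
    (fun v _ => by split_ifs; exacts [(p i).2.1 v, le_rfl]) (Finset.mem_univ w)
  simpa [colProb] using this

theorem rowProb_le_one (i j : ℕ) : S.rowProb p i j ≤ 1 := by
  rw [← (p i).2.2]
  exact Finset.sum_le_sum fun v _ => by split_ifs; exacts [le_rfl, (p i).2.1 v]

theorem colProb_le_one (i j : ℕ) : S.colProb p i j ≤ 1 := by
  rw [← (p i).2.2]
  exact Finset.sum_le_sum fun v _ => by split_ifs; exacts [le_rfl, (p i).2.1 v]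

/-- The information `-log p_i(w)` of a digit. -/
def info (i : ℕ) (w : S.D i) : ℝ := -Real.log ((p i).1 w)

/-- The information `-log q_i(w)` of the row of a digit. -/
def rowInfo (i : ℕ) (w : S.D i) : ℝ := -Real.log (S.rowProb p i w.1.2)

/-- The information of the column of a digit. -/
def colInfo (i : ℕ) (w : S.D i) : ℝ := -Real.log (S.colProb p i w.1.1)

/-- A general `q` between `p` and `1` treats the digit, row and column probabilities at once. At
most `N²` digits contribute at most `2` each to the second moment. -/
theorem ae_eventually_abs_sum_neg_log_sub_le {N : ℕ} (hN : ∀ k, S.n k ≤ N ∧ S.m k ≤ N)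
    {q : ∀ i, S.D i → ℝ} (hq : ∀ i w, (p i).1 w ≤ q i w) (hq1 : ∀ i w, q i w ≤ 1)
    {ε : ℝ} (hε : 0 < ε) :
    ∀ᵐ w ∂(S.seqMeasure p), ∀ᶠ n : ℕ in atTop,
      |∑ i ∈ Finset.range n, -Real.log (q i (w i)) -
        ∑ i ∈ Finset.range n, ∑ w : S.D i, (p i).1 w * -Real.log (q i w)| ≤ ε * n := by
  refine S.ae_eventually_abs_sum_sub_le_seqMeasure p (f := fun i w => -Real.log (q i w))
    (C := ((N * N : ℕ) : ℝ) * 2) (fun i w => neg_nonneg.2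
      (Real.log_nonpos (((p i).2.1 w).trans (hq i w)) (hq1 i w))) (fun i => ?_) hε
  calc ∑ w : S.D i, (p i).1 w * (-Real.log (q i w)) ^ 2 ≤ ∑ w : S.D i, (2 : ℝ) :=
        Finset.sum_le_sum fun w _ => mul_neg_log_sq_le ((p i).2.1 w) (hq i w) (hq1 i w)
    _ = ((S.D i).card : ℝ) * 2 := by simp
    _ ≤ _ := by
      gcongr
      refine (Finset.card_le_card (S.D_subset i)).trans ?_
      rw [Finset.card_product, Finset.card_range, Finset.card_range]
      exact Nat.mul_le_mul (hN i).1 (hN i).2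

/-- Discards the sequences on which the convention `Real.log 0 = 0` would break `exp (-info) = p`.
-/
theorem ae_forall_apply_pos : ∀ᵐ w ∂(S.seqMeasure p), ∀ i, 0 < (p i).1 (w i) := by
  refine ae_all_iff.2 fun i => ?_
  have hmp : MeasurePreserving (Function.eval i) (S.seqMeasure p) (S.levelMeasure p i) :=
    measurePreserving_eval_infinitePi _ _
  have : ∀ᵐ v ∂(S.levelMeasure p i), 0 < (p i).1 v := by
    classical
    rw [ae_iff, levelMeasure_apply, ENNReal.ofReal_eq_zero]
    refine Finset.sum_nonpos fun v _ => ?_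
    split_ifs with h
    exacts [not_lt.1 h, le_rfl]
  exact hmp.quasiMeasurePreserving.ae this

end Marginals

/-! ### Measure of approximate squares. -/

section Cells

theorem seqMeasure_pi (s : Finset ℕ) (t : ∀ i, Set (S.D i)) :
    S.seqMeasure p (Set.pi s t) = ∏ i ∈ s, S.levelMeasure p i (t i) :=
  Measure.infinitePi_pi _ fun i _ => (t i).toFinite.measurableSet

/-- The cell is a cylinder: both digits are prescribed below `a`, only the row between `a` and `b`.
-/
theorem seqMeasure_cell_of_le {a b : ℕ} (hab : a ≤ b) (w : S.Seq) :
    S.seqMeasure p (S.cell a b w) = ENNReal.ofReal ((∏ i ∈ Finset.range a, (p i).1 (w i)) *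
      ∏ i ∈ Finset.Ico a b, S.rowProb p i (w i).1.2) := by
  classical
  have hset : S.cell a b w = Set.pi (Finset.range b) fun i =>
      {v | (i < a → (w i).1.1 = v.1.1) ∧ (w i).1.2 = v.1.2} := by
    ext v
    simp only [cell, Set.mem_ofPred_eq, Set.mem_pi, Finset.coe_range, Set.mem_Iio]
    exact ⟨fun h i hi => ⟨h.1 i, h.2 i hi⟩,
      fun h => ⟨fun i hi => (h i (hi.trans_le hab)).1 hi, fun i hi => (h i hi).2⟩⟩
  rw [hset, seqMeasure_pi, ← Finset.prod_range_mul_prod_Ico _ hab,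
    ENNReal.ofReal_mul (Finset.prod_nonneg fun i _ => (p i).2.1 _),
    ENNReal.ofReal_prod_of_nonneg fun i _ => (p i).2.1 _,
    ENNReal.ofReal_prod_of_nonneg fun i _ => ((p i).2.1 _).trans (S.apply_le_rowProb p i _)]
  congr 1
  · refine Finset.prod_congr rfl fun i hi => ?_
    rw [levelMeasure_apply]
    congr 1
    rw [Finset.sum_eq_single (w i)]
    · simp
    · intro v _ hv
      refine if_neg fun h => hv ?_
      exact Subtype.ext (Prod.ext (h.1 (Finset.mem_range.1 hi)).symm h.2.symm)
    · simp
  · refine Finset.prod_congr rfl fun i hi => ?_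
    rw [levelMeasure_apply, rowProb]
    congr 1
    refine Finset.sum_congr rfl fun v _ => ?_
    have : ¬ i < a := not_lt.2 (Finset.mem_Ico.1 hi).1
    simp [this, eq_comm]

theorem seqMeasure_cell_of_ge {a b : ℕ} (hab : b ≤ a) (w : S.Seq) :
    S.seqMeasure p (S.cell a b w) = ENNReal.ofReal ((∏ i ∈ Finset.range b, (p i).1 (w i)) *
      ∏ i ∈ Finset.Ico b a, S.colProb p i (w i).1.1) := by
  classical
  have hset : S.cell a b w = Set.pi (Finset.range a) fun i =>
      {v | (w i).1.1 = v.1.1 ∧ (i < b → (w i).1.2 = v.1.2)} := by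
    ext v
    simp only [cell, Set.mem_ofPred_eq, Set.mem_pi, Finset.coe_range, Set.mem_Iio]
    exact ⟨fun h i hi => ⟨h.1 i hi, h.2 i⟩,
      fun h => ⟨fun i hi => (h i hi).1, fun i hi => (h i (hi.trans_le hab)).2 hi⟩⟩
  rw [hset, seqMeasure_pi, ← Finset.prod_range_mul_prod_Ico _ hab,
    ENNReal.ofReal_mul (Finset.prod_nonneg fun i _ => (p i).2.1 _),
    ENNReal.ofReal_prod_of_nonneg fun i _ => (p i).2.1 _,
    ENNReal.ofReal_prod_of_nonneg fun i _ => ((p i).2.1 _).trans (S.apply_le_colProb p i _)]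
  congr 1
  · refine Finset.prod_congr rfl fun i hi => ?_
    rw [levelMeasure_apply]
    congr 1
    rw [Finset.sum_eq_single (w i)]
    · simp
    · intro v _ hv
      refine if_neg fun h => hv ?_
      exact Subtype.ext (Prod.ext h.1.symm (h.2 (Finset.mem_range.1 hi)).symm)
    · simp
  · refine Finset.prod_congr rfl fun i hi => ?_
    rw [levelMeasure_apply, colProb]
    congr 1
    refine Finset.sum_congr rfl fun v _ => ?_
    have : ¬ i < b := not_lt.2 (Finset.mem_Ico.1 hi).1
    simp [this, eq_comm]

/-- The information of the `k`-th approximate square containing `w`. -/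
def cellInfo (k : ℕ) (w : S.Seq) : ℝ :=
  if S.ell k ≤ k then ∑ i ∈ Finset.range (S.ell k), S.info p i (w i) +
      ∑ i ∈ Finset.Ico (S.ell k) k, S.rowInfo p i (w i)
  else ∑ i ∈ Finset.range k, S.info p i (w i) + ∑ i ∈ Finset.Ico k (S.ell k), S.colInfo p i (w i)

theorem exp_neg_sum_neg_log {s : Finset ℕ} {f : ℕ → ℝ} (hf : ∀ i ∈ s, 0 < f i) :
    Real.exp (-∑ i ∈ s, -Real.log (f i)) = ∏ i ∈ s, f i := by
  rw [← Finset.sum_neg_distrib, Real.exp_sum]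
  exact Finset.prod_congr rfl fun i hi => by rw [neg_neg, Real.exp_log (hf i hi)]

/-- The measure of the `k`-th approximate square. -/
theorem seqMeasure_cell_ell (k : ℕ) {w : S.Seq} (hw : ∀ i, 0 < (p i).1 (w i)) :
    S.seqMeasure p (S.cell (S.ell k) k w) = ENNReal.ofReal (Real.exp (-S.cellInfo p k w)) := by
  unfold cellInfo
  split_ifs with h
  · rw [S.seqMeasure_cell_of_le p h, neg_add, Real.exp_add]
    unfold info rowInfo
    rw [exp_neg_sum_neg_log fun i _ => hw i,
      exp_neg_sum_neg_log fun i _ => (hw i).trans_le (S.apply_le_rowProb p i _)]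
  · rw [S.seqMeasure_cell_of_ge p (not_le.1 h).le, neg_add, Real.exp_add]
    unfold info colInfo
    rw [exp_neg_sum_neg_log fun i _ => hw i,
      exp_neg_sum_neg_log fun i _ => (hw i).trans_le (S.apply_le_colProb p i _)]

theorem ae_eventually_abs_cellInfo_sub_le {N : ℕ} (hN : ∀ k, S.n k ≤ N ∧ S.m k ≤ N)
    {ε : ℝ} (hε : 0 < ε) :
    ∀ᵐ w ∂(S.seqMeasure p), ∀ᶠ k : ℕ in atTop, |S.cellInfo p k w - S.entropy p k| ≤ ε * k := by
  -- The marginal block is a difference of two initial sums, so three errors occur, at times `k` or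
  -- `S.ell k ≤ N * k`, each at most `η * N * k`.
  set η := ε / (3 * N) with hη
  have hN0 : (1 : ℝ) ≤ N := by
    exact_mod_cast (by decide : 1 ≤ 2).trans (two_le_bound hN)
  have hη0 : 0 < η := by positivity
  have hηN : 3 * (η * N) = ε := by rw [hη]; field_simp
  filter_upwards [S.ae_eventually_abs_sum_neg_log_sub_le p hN (q := fun i w => (p i).1 w)
      (fun i w => le_rfl) (fun i w => (S.apply_le_rowProb p i w).trans (S.rowProb_le_one p i _)) hη0,
    S.ae_eventually_abs_sum_neg_log_sub_le p hN (q := fun i w => S.rowProb p i w.1.2)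
      (S.apply_le_rowProb p) (fun i w => S.rowProb_le_one p i _) hη0,
    S.ae_eventually_abs_sum_neg_log_sub_le p hN (q := fun i w => S.colProb p i w.1.1)
      (S.apply_le_colProb p) (fun i w => S.colProb_le_one p i _) hη0] with w h1 h2 h3
  have hell := tendsto_ell hN
  filter_upwards [h1, h2, h3, hell.eventually h1, hell.eventually h2, hell.eventually h3]
    with k a1 a2 a3 b1 b2 b3
  have hk : η * (k : ℝ) ≤ η * N * k := by
    rw [mul_assoc]; gcongr; exact le_mul_of_one_le_left (Nat.cast_nonneg k) hN0
  have hl : η * (S.ell k : ℝ) ≤ η * N * k := by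
    rw [mul_assoc]; gcongr; exact_mod_cast ell_le hN k
  have hεk : ε * k = 3 * (η * N * k) := by rw [← hηN]; ring
  rw [hεk]
  unfold cellInfo entropy info rowInfo colInfo
  simp only [mul_neg, Finset.sum_neg_distrib] at a1 a2 a3 b1 b2 b3 ⊢
  rw [abs_le] at *
  split_ifs with h
  · rw [Finset.sum_Ico_eq_sub _ h, Finset.sum_Ico_eq_sub _ h]
    constructor <;> linarith [a1.1, a1.2, a2.1, a2.2, b1.1, b1.2, b2.1, b2.2]
  · have h := (not_le.1 h).le
    rw [Finset.sum_Ico_eq_sub _ h, Finset.sum_Ico_eq_sub _ h]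
    constructor <;> linarith [a1.1, a1.2, a3.1, a3.2, b1.1, b1.2, b3.1, b3.2]

end Cells

end MoranData

/-! ### Separation conditions keep typical points away from cell boundaries. -/

namespace MoranData

variable (S : MoranData) (p : S.ProbSeq)

theorem summable_pow_floor {C ε : ℝ} (hC0 : 0 < C) (hC1 : C < 1) (hε : 0 < ε) :
    Summable fun k : ℕ => C ^ ⌊ε * k⌋₊ := by
  have hg : Summable fun k : ℕ => C⁻¹ * (C ^ ε) ^ k :=
    (summable_geometric_of_lt_one (Real.rpow_nonneg hC0.le _)
      (Real.rpow_lt_one hC0.le hC1 hε)).mul_left _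
  refine hg.of_nonneg_of_le (fun k => by positivity) fun k => ?_
  rw [← Real.rpow_natCast C, ← Real.rpow_natCast (C ^ ε), ← Real.rpow_mul hC0.le,
    ← Real.rpow_neg_one, ← Real.rpow_add hC0]
  refine Real.rpow_le_rpow_of_exponent_ge hC0 hC1.le ?_
  linarith [Nat.lt_floor_add_one (ε * k)]

/-- By independence, a window of `⌊ε k⌋` levels is entirely bad with probability at most `C ^ ⌊ε
k⌋`; this is summable, so Borel–Cantelli applies. -/
theorem ae_eventually_exists_not_of_measure_le {bad : ∀ i, Set (S.D i)} {C : ℝ} (hC0 : 0 < C)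
    (hC1 : C < 1) (hbad : ∀ i, S.levelMeasure p i (bad i) ≤ ENNReal.ofReal C) {ε : ℝ} (hε : 0 < ε)
    (L : ℕ → ℕ) :
    ∀ᵐ w ∂(S.seqMeasure p), ∀ᶠ k : ℕ in atTop,
      ∃ i, L k ≤ i ∧ i < L k + ⌊ε * k⌋₊ ∧ w i ∉ bad i := by
  have hmeas : ∀ k : ℕ, S.seqMeasure p (Set.pi (Finset.Ico (L k) (L k + ⌊ε * k⌋₊)) bad) ≤
      ENNReal.ofReal (C ^ ⌊ε * k⌋₊) := by
    intro k
    rw [seqMeasure_pi, ENNReal.ofReal_pow hC0.le]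
    refine (Finset.prod_le_prod' fun i _ => hbad i).trans ?_
    simp
  have hsum : ∑' k : ℕ, S.seqMeasure p (Set.pi (Finset.Ico (L k) (L k + ⌊ε * k⌋₊)) bad) ≠ ∞ :=
    ne_top_of_le_ne_top (summable_pow_floor hC0 hC1 hε).tsum_ofReal_ne_top
      (ENNReal.tsum_le_tsum hmeas)
  filter_upwards [ae_eventually_notMem hsum] with w hw
  filter_upwards [hw] with k hk
  simp only [Set.mem_pi, Finset.coe_Ico, Set.mem_Ico, not_forall] at hk
  obtain ⟨i, hi, hi'⟩ := hk
  exact ⟨i, hi.1, hi.2, hi'⟩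

variable {S}

/-- Without a centred level in the window, the counts at its two ends agree, whereas density `c`
forces growth by `c ⌊ε k⌋` up to an arbitrarily small multiple of `k`. -/
theorem FSC.eventually_exists_isCentred (hS : S.FSC) {L : ℕ → ℕ} (hL : Tendsto L atTop atTop)
    {B : ℕ} (hB : ∀ k, L k ≤ B * k) {ε : ℝ} (hε : 0 < ε) :
    ∀ᶠ k : ℕ in atTop, ∃ i, L k ≤ i ∧ i < L k + ⌊ε * k⌋₊ ∧ S.IsCentred i := by
  classical
  obtain ⟨c, hc, hlim⟩ := hS
  set f : ℕ → ℝ := fun n => (((Finset.range n).filter fun k => S.IsCentred k).card : ℝ) with hf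
  -- Makes the total density error at most `c ε k / 2`, while `⌊ε k⌋ > ε k / 2` once `k > 2 / ε`.
  set η := c * ε / (2 * (2 * B + ε)) with hη
  have hden : (0 : ℝ) < 2 * (2 * B + ε) := by positivity
  have hη0 : 0 < η := by positivity
  have hηB : η * (2 * B + ε) = c * ε / 2 := by rw [hη]; field_simp
  have hev : ∀ᶠ n : ℕ in atTop, (c - η) * n ≤ f n ∧ f n ≤ (c + η) * n := by
    filter_upwards [hlim.eventually (Ioo_mem_nhds (by linarith : c - η < c)
      (by linarith : c < c + η)), eventually_gt_atTop 0] with n hn hn0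
    have hn0' : (0 : ℝ) < n := by exact_mod_cast hn0
    have hn' : f n / n ∈ Set.Ioo (c - η) (c + η) := by
      convert! hn
    exact ⟨((lt_div_iff₀ hn0').1 hn'.1).le, ((div_lt_iff₀ hn0').1 hn'.2).le⟩
  have hLs : Tendsto (fun k : ℕ => L k + ⌊ε * k⌋₊) atTop atTop :=
    tendsto_atTop_mono (fun k => Nat.le_add_right _ _) hL
  have hlarge : ∀ᶠ k : ℕ in atTop, 2 / ε < k := tendsto_natCast_atTop_atTop.eventually_gt_atTop _
  filter_upwards [hL.eventually hev, hLs.eventually hev, hlarge] with k h1 h2 h3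
  by_contra! hne
  have heq : f (L k + ⌊ε * k⌋₊) = f (L k) := by
    simp only [hf]
    congr 2
    ext i
    simp only [Finset.mem_filter, Finset.mem_range]
    refine ⟨fun h => ⟨?_, h.2⟩, fun h => ⟨by omega, h.2⟩⟩
    by_contra hi
    exact hne i (not_lt.1 hi) h.1 h.2
  have hfl : (⌊ε * k⌋₊ : ℝ) ≤ ε * k := Nat.floor_le (by positivity)
  have hfl' := Nat.lt_floor_add_one (ε * k)
  have hLB : (L k : ℝ) ≤ B * k := by exact_mod_cast hB k
  have h4 : (c - η) * (L k + ⌊ε * k⌋₊) ≤ (c + η) * L k := by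
    have := h2.1.trans (heq.le.trans h1.2)
    push_cast at this
    exact this
  rw [div_lt_iff₀ hε] at h3
  have h5 : c * (⌊ε * k⌋₊ : ℝ) ≤ η * (2 * B + ε) * k := by
    have : η * (2 * (L k : ℝ) + ⌊ε * k⌋₊) ≤ η * (2 * (B * k) + ε * k) := by gcongr
    nlinarith
  rw [hηB] at h5
  nlinarith

theorem levelMeasure_fst_eq (i j : ℕ) :
    S.levelMeasure p i {v | v.1.1 = j} = ENNReal.ofReal (S.colProb p i j) := by
  classical
  rw [levelMeasure_apply, colProb]
  rfl

theorem levelMeasure_snd_eq (i j : ℕ) :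
    S.levelMeasure p i {v | v.1.2 = j} = ENNReal.ofReal (S.rowProb p i j) := by
  classical
  rw [levelMeasure_apply, rowProb]
  rfl

variable {p}

/-- Under either separation condition, typical points stay away from the boundary of their
approximate squares, up to a subexponential factor. -/
theorem ae_eventually_isInner {N : ℕ} (hN : ∀ k, S.n k ≤ N ∧ S.m k ≤ N)
    (hsep : S.FSC ∨ S.MSC p) {ε : ℝ} (hε : 0 < ε) :
    ∀ᵐ w ∂(S.seqMeasure p), ∀ᶠ k : ℕ in atTop, S.IsInner (S.ell k) k ⌊ε * k⌋₊ w := by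
  rcases hsep with h | ⟨C, hC0, hC1, h⟩
  -- One centred level after `S.ell k` settles both column conditions and one after `k` both row
  -- conditions, for every sequence.
  · refine ae_of_all _ fun w => ?_
    filter_upwards [h.eventually_exists_isCentred (tendsto_ell hN) (ell_le hN) hε,
      h.eventually_exists_isCentred (L := id) tendsto_id (B := 1) (fun k => (one_mul k).ge) hε]
      with k ⟨i, hi, hi', hic⟩ ⟨j, hj, hj', hjc⟩
    have hi1 := hic _ (w i).2
    have hj1 := hjc _ (w j).2
    exact ⟨⟨i, hi, hi', hi1.1⟩, ⟨i, hi, hi', hi1.2.1⟩, ⟨j, hj, hj', hj1.2.2.1⟩,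
      ⟨j, hj, hj', hj1.2.2.2⟩⟩
  · have hle : ∀ {x : ℝ}, x < C → ENNReal.ofReal x ≤ ENNReal.ofReal C :=
      fun hx => ENNReal.ofReal_le_ofReal hx.le
    filter_upwards [
      S.ae_eventually_exists_not_of_measure_le p hC0 hC1
        (fun i => (levelMeasure_fst_eq p i 0).trans_le (hle (h i).2.2.1)) hε S.ell,
      S.ae_eventually_exists_not_of_measure_le p hC0 hC1
        (fun i => (levelMeasure_fst_eq p i _).trans_le (hle (h i).2.2.2)) hε S.ell,
      S.ae_eventually_exists_not_of_measure_le p hC0 hC1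
        (fun i => (levelMeasure_snd_eq p i 0).trans_le (hle (h i).1)) hε id,
      S.ae_eventually_exists_not_of_measure_le p hC0 hC1
        (fun i => (levelMeasure_snd_eq p i _).trans_le (hle (h i).2.1)) hε id]
      with w h1 h2 h3 h4
    filter_upwards [h1, h2, h3, h4] with k k1 k2 k3 k4
    exact ⟨k1, k2, k3, k4⟩

end MoranData

theorem measurableSet_eventually_atTop {X : Type*} [MeasurableSpace X] {P : ℕ → X → Prop}
    (hP : ∀ k, MeasurableSet {x | P k x}) : MeasurableSet {x | ∀ᶠ k in atTop, P k x} := by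
  have : {x | ∀ᶠ k in atTop, P k x} = ⋃ K, ⋂ k, ⋂ (_ : K ≤ k), {x | P k x} := by
    ext x
    simp [eventually_atTop]
  rw [this]
  exact .iUnion fun K => .iInter fun k => .iInter fun _ => hP k

theorem ofReal_exp_le_ofReal_rpow {r x t : ℝ} (hr : 0 < r) (ht : 0 ≤ t) (h : x ≤ Real.log r * t) :
    ENNReal.ofReal (Real.exp x) ≤ ENNReal.ofReal r ^ t := by
  rw [ENNReal.ofReal_rpow_of_nonneg hr.le ht, Real.rpow_def_of_pos hr]
  exact ENNReal.ofReal_le_ofReal (Real.exp_le_exp.2 h)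

theorem ofReal_rpow_le_ofReal_exp {r x t : ℝ} (hr : 0 < r) (ht : 0 ≤ t) (h : Real.log r * t ≤ x) :
    ENNReal.ofReal r ^ t ≤ ENNReal.ofReal (Real.exp x) := by
  rw [ENNReal.ofReal_rpow_of_nonneg hr.le ht, Real.rpow_def_of_pos hr]
  exact ENNReal.ofReal_le_ofReal (Real.exp_le_exp.2 h)

theorem cellLength_add_ge {c : ℕ → ℕ} {N : ℕ} (hc : ∀ k, 2 ≤ c k) (hN : ∀ k, c k ≤ N) (k s : ℕ) :
    cellLength c k * (N : ℝ)⁻¹ ^ s ≤ cellLength c (k + s) := by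
  rw [cellLength, cellLength, Finset.prod_range_add]
  gcongr
  calc (N : ℝ)⁻¹ ^ s = ∏ _h ∈ Finset.range s, (N : ℝ)⁻¹ := by simp
    _ ≤ _ := by
      refine Finset.prod_le_prod (fun _ _ => by positivity) fun h _ => ?_
      refine inv_anti₀ (by have := hc (k + h); positivity) (by exact_mod_cast hN _)

/-! ### Measures of balls around typical points. -/

namespace MoranData

variable (S : MoranData) (p : S.ProbSeq)

instance : IsProbabilityMeasure (S.moranMeasure p) :=
  Measure.isProbabilityMeasure_map S.measurable_proj.aemeasurable

theorem moranMeasure_closedBall (x : EuclideanSpace ℝ (Fin 2)) (r : ℝ) :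
    S.moranMeasure p (Metric.closedBall x r) =
      S.seqMeasure p (S.proj ⁻¹' Metric.closedBall x r) :=
  Measure.map_apply S.measurable_proj Metric.isClosed_closedBall.measurableSet

theorem log_cellLength_m (k : ℕ) :
    Real.log (cellLength S.m k) = -∑ i ∈ Finset.range k, Real.log (S.m i) := by
  rw [cellLength, Real.log_prod fun i _ => by have := S.two_le_m i; positivity]
  simp [Real.log_inv]

theorem mul_log_two_le (k : ℕ) :
    k * Real.log 2 ≤ ∑ i ∈ Finset.range k, Real.log (S.m i) := by
  calc k * Real.log 2 = ∑ _i ∈ Finset.range k, Real.log 2 := by simp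
    _ ≤ _ := Finset.sum_le_sum fun i _ =>
      Real.log_le_log (by norm_num) (by exact_mod_cast S.two_le_m i)

theorem sum_log_m_pos {k : ℕ} (hk : 0 < k) : 0 < ∑ i ∈ Finset.range k, Real.log (S.m i) :=
  lt_of_lt_of_le (mul_pos (by exact_mod_cast hk) (Real.log_pos (by norm_num))) (S.mul_log_two_le k)

theorem tendsto_cellLength_m : Tendsto (cellLength S.m) atTop (𝓝 0) := by
  refine squeeze_zero (fun k => (cellLength_pos S.two_le_m k).le) (fun k => ?_)
    (tendsto_pow_atTop_nhds_zero_of_lt_one (r := (1 / 2 : ℝ)) (by norm_num) (by norm_num))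
  rw [cellLength_eq_inv, one_div, inv_pow]
  exact inv_anti₀ (by positivity) (by exact_mod_cast two_pow_le_prod S.two_le_m k)

theorem entropy_nonneg (k : ℕ) : 0 ≤ S.entropy p k := by
  have key : ∀ i (w : S.D i) {q : ℝ}, (p i).1 w ≤ q → q ≤ 1 → (p i).1 w * Real.log q ≤ 0 :=
    fun i w q h1 h2 => mul_nonpos_of_nonneg_of_nonpos ((p i).2.1 w)
      (Real.log_nonpos (((p i).2.1 w).trans h1) h2)
  have h1 : ∀ i (w : S.D i), (p i).1 w ≤ 1 := fun i w =>
    (S.apply_le_rowProb p i w).trans (S.rowProb_le_one p i _)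
  unfold entropy
  split_ifs
  all_goals
    refine neg_nonneg.2 (add_nonpos (Finset.sum_nonpos fun i _ => Finset.sum_nonpos fun w _ =>
      key i w le_rfl (h1 i w)) (Finset.sum_nonpos fun i _ => Finset.sum_nonpos fun w _ => ?_))
  · exact key i w (S.apply_le_rowProb p i w) (S.rowProb_le_one p i _)
  · exact key i w (S.apply_le_colProb p i w) (S.colProb_le_one p i _)

theorem entropyRatio_nonneg (k : ℕ) : 0 ≤ S.entropyRatio p k :=
  div_nonneg (S.entropy_nonneg p k) (Finset.sum_nonneg fun i _ =>
    Real.log_nonneg (by exact_mod_cast (by decide : 1 ≤ 2).trans (S.two_le_m i)))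

variable {S} {N : ℕ}

/-- Both sides of the approximate square are at most `cellLength S.m k`, so the ball contains its
projection. -/
theorem ae_eventually_le_moranMeasure_closedBall (hN : ∀ k, S.n k ≤ N ∧ S.m k ≤ N) {ε : ℝ}
    (hε : 0 < ε) :
    ∀ᵐ x ∂(S.moranMeasure p), ∀ᶠ k : ℕ in atTop,
      ENNReal.ofReal (Real.exp (-(S.entropy p k + ε * k))) ≤
        S.moranMeasure p (Metric.closedBall x (2 * cellLength S.m k)) := by
  refine (ae_map_iff S.measurable_proj.aemeasurable (measurableSet_eventually_atTop fun k =>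
    measurableSet_le measurable_const (measurable_measure_closedBall _ _))).2 ?_
  filter_upwards [S.ae_eventually_abs_cellInfo_sub_le p hN hε, S.ae_forall_apply_pos p]
    with w hw hpos
  filter_upwards [hw] with k hk
  rw [moranMeasure_closedBall]
  calc _ ≤ S.seqMeasure p (S.cell (S.ell k) k w) := by
        rw [S.seqMeasure_cell_ell p k hpos]
        refine ENNReal.ofReal_le_ofReal (Real.exp_le_exp.2 ?_)
        linarith [(abs_le.1 hk).2]
    _ ≤ _ := by
      refine measure_mono fun v hv => ?_
      rw [Set.mem_preimage, Metric.mem_closedBall]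
      linarith [S.dist_proj_le hv, S.cellLength_ell_le k]

/-- The gap `(t - t') ∑ log m_i ≥ (t - t') k log 2` is spent half on `ε k` and half on `t log 2`,
which comes from the factor `2` in the radius. -/
theorem eventually_rpow_le_exp {t t' : ℝ} (ht : 0 ≤ t) (htt : t' < t) :
    ∃ ε > 0, ∀ᶠ k : ℕ in atTop, S.entropyRatio p k < t' →
      ENNReal.ofReal (2 * cellLength S.m k) ^ t ≤
        ENNReal.ofReal (Real.exp (-(S.entropy p k + ε * k))) := by
  have hlog2 : 0 < Real.log 2 := Real.log_pos (by norm_num)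
  have hδ : 0 < t - t' := sub_pos.2 htt
  refine ⟨(t - t') * Real.log 2 / 2, by positivity, ?_⟩
  filter_upwards [eventually_gt_atTop 0, tendsto_natCast_atTop_atTop.eventually_ge_atTop
    (2 * t / (t - t'))] with k hk0 hk hlt
  have hpos := cellLength_pos S.two_le_m k
  refine ofReal_rpow_le_ofReal_exp (by positivity) ht ?_
  rw [Real.log_mul (by norm_num) hpos.ne', log_cellLength_m]
  rw [entropyRatio, div_lt_iff₀ (S.sum_log_m_pos hk0)] at hlt
  rw [div_le_iff₀ hδ] at hk
  have h1 := mul_le_mul_of_nonneg_left (S.mul_log_two_le k) hδ.le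
  have h2 := mul_le_mul_of_nonneg_right hk hlog2.le
  linarith

/-- A radius at which the ball around a typical point lies in an approximate square. -/
def innerRadius (S : MoranData) (N : ℕ) (ε : ℝ) (k : ℕ) : ℝ :=
  cellLength S.m k * (N : ℝ)⁻¹ ^ (⌊ε * k⌋₊ + 2)

theorem innerRadius_pos (hN : ∀ k, S.n k ≤ N ∧ S.m k ≤ N) (ε : ℝ) (k : ℕ) :
    0 < S.innerRadius N ε k := by
  have := two_le_bound hN
  exact mul_pos (cellLength_pos S.two_le_m k) (by positivity)

theorem innerRadius_succ_le (hN : ∀ k, S.n k ≤ N ∧ S.m k ≤ N) {ε : ℝ} (hε : 0 < ε) (k : ℕ) :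
    S.innerRadius N ε (k + 1) ≤ S.innerRadius N ε k := by
  have h2 : (1 : ℝ) ≤ N := by exact_mod_cast (by decide : 1 ≤ 2).trans (two_le_bound hN)
  unfold innerRadius
  gcongr ?_ * ?_
  · exact (cellLength_pos S.two_le_m k).le
  · exact cellLength_antitone S.two_le_m k.le_succ
  · refine pow_le_pow_of_le_one (by positivity) (inv_le_one_of_one_le₀ h2) ?_
    gcongr
    exact k.le_succ

theorem tendsto_innerRadius (hN : ∀ k, S.n k ≤ N ∧ S.m k ≤ N) (ε : ℝ) :
    Tendsto (S.innerRadius N ε) atTop (𝓝 0) := by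
  have h2 : (1 : ℝ) ≤ N := by exact_mod_cast (by decide : 1 ≤ 2).trans (two_le_bound hN)
  refine squeeze_zero (fun k => (innerRadius_pos hN ε k).le) (fun k => ?_) S.tendsto_cellLength_m
  exact mul_le_of_le_one_right (cellLength_pos S.two_le_m k).le
    (pow_le_one₀ (by positivity) (inv_le_one_of_one_le₀ h2))

theorem log_innerRadius (hN : ∀ k, S.n k ≤ N ∧ S.m k ≤ N) (ε : ℝ) (k : ℕ) :
    Real.log (S.innerRadius N ε k) = -(∑ i ∈ Finset.range k, Real.log (S.m i) +
      (⌊ε * k⌋₊ + 2) * Real.log N) := by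
  have := two_le_bound hN
  rw [innerRadius, Real.log_mul (cellLength_pos S.two_le_m k).ne' (by positivity),
    log_cellLength_m, Real.log_pow, Real.log_inv]
  push_cast
  ring

/-- Of the two extra factors `N⁻¹`, one pays for passing from row length to column length
(`cellLength_le_ell`), the other makes the inequalities strict. -/
theorem innerRadius_lt (hN : ∀ k, S.n k ≤ N ∧ S.m k ≤ N) (ε : ℝ) (k : ℕ) :
    S.innerRadius N ε k < cellLength S.n (S.ell k + ⌊ε * k⌋₊) ∧
      S.innerRadius N ε k < cellLength S.m (k + ⌊ε * k⌋₊) := by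
  have hN2 := two_le_bound hN
  have hN0 : (0 : ℝ) < N := by positivity
  have hN1 : (N : ℝ)⁻¹ < 1 := inv_lt_one_of_one_lt₀ (by exact_mod_cast hN2)
  have hm := cellLength_pos S.two_le_m k
  have h1 := cellLength_add_ge S.two_le_n (fun k => (hN k).1) (S.ell k) ⌊ε * k⌋₊
  have h2 := cellLength_add_ge S.two_le_m (fun k => (hN k).2) k ⌊ε * k⌋₊
  have h3 := cellLength_le_ell hN k
  have hpow : (0 : ℝ) < (N : ℝ)⁻¹ ^ ⌊ε * k⌋₊ := by positivity
  have hinv : (0 : ℝ) < (N : ℝ)⁻¹ := by positivity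
  have h4 : S.innerRadius N ε k < cellLength S.m k * (N : ℝ)⁻¹ ^ ⌊ε * k⌋₊ * (N : ℝ)⁻¹ := by
    rw [innerRadius, pow_add, pow_two, ← mul_assoc, ← mul_assoc]
    exact mul_lt_of_lt_one_right (by positivity) hN1
  constructor
  · refine (h4.trans_le ?_).trans_le h1
    rw [← div_eq_mul_inv, div_le_iff₀ hN0]
    nlinarith
  · refine (h4.trans_le ?_).trans_le h2
    exact mul_le_of_le_one_right (by positivity) hN1.le

variable {p}

theorem ae_eventually_moranMeasure_closedBall_le (hN : ∀ k, S.n k ≤ N ∧ S.m k ≤ N)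
    (hsep : S.FSC ∨ S.MSC p) {ε : ℝ} (hε : 0 < ε) :
    ∀ᵐ x ∂(S.moranMeasure p), ∀ᶠ k : ℕ in atTop,
      S.moranMeasure p (Metric.closedBall x (S.innerRadius N ε k)) ≤
        ENNReal.ofReal (Real.exp (-(S.entropy p k - ε * k))) := by
  refine (ae_map_iff S.measurable_proj.aemeasurable (measurableSet_eventually_atTop fun k =>
    measurableSet_le (measurable_measure_closedBall _ _) measurable_const)).2 ?_
  filter_upwards [S.ae_eventually_abs_cellInfo_sub_le p hN hε, S.ae_forall_apply_pos p,
    ae_eventually_isInner hN hsep hε] with w hw hpos hin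
  filter_upwards [hw, hin] with k hk hink
  rw [moranMeasure_closedBall]
  calc _ ≤ S.seqMeasure p (S.cell (S.ell k) k w) := by
        refine measure_mono fun v hv => ?_
        have hr := innerRadius_lt hN ε k
        exact S.mem_cell_of_dist_lt hink (lt_of_le_of_lt hv hr.1) (lt_of_le_of_lt hv hr.2)
    _ ≤ _ := by
      rw [S.seqMeasure_cell_ell p k hpos]
      refine ENNReal.ofReal_le_ofReal (Real.exp_le_exp.2 ?_)
      linarith [(abs_le.1 hk).1]

theorem eventually_exp_le_rpow (hN : ∀ k, S.n k ≤ N ∧ S.m k ≤ N) {t t' : ℝ} (ht : 0 ≤ t)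
    (htt : t < t') :
    ∃ ε > 0, ∀ᶠ k : ℕ in atTop, t' < S.entropyRatio p k →
      ENNReal.ofReal (Real.exp (-(S.entropy p k - ε * k))) ≤
        ENNReal.ofReal (S.innerRadius N ε (k + 1)) ^ t := by
  have hlog2 : 0 < Real.log 2 := Real.log_pos (by norm_num)
  have hN2 := two_le_bound hN
  have hlogN : 0 < Real.log N := Real.log_pos (by exact_mod_cast hN2)
  have hδ : 0 < t' - t := sub_pos.2 htt
  -- Here `ε` enters both the measure bound and the radius, with total cost `ε k (1 + t log N)`:
  -- half of the gap. The other half absorbs the constant `t (ε + 3) log N`, which includes the step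
  -- from `k` to `k + 1`.
  set ε := (t' - t) * Real.log 2 / (2 * (1 + t * Real.log N)) with hεdef
  have hε : 0 < ε := by positivity
  have hεmul : ε * (1 + t * Real.log N) = (t' - t) * Real.log 2 / 2 := by
    rw [hεdef]; field_simp
  refine ⟨ε, hε, ?_⟩
  filter_upwards [eventually_gt_atTop 0, tendsto_natCast_atTop_atTop.eventually_ge_atTop
    (2 * (t * (ε + 3) * Real.log N) / ((t' - t) * Real.log 2))] with k hk0 hk hlt
  refine ofReal_exp_le_ofReal_rpow (innerRadius_pos hN ε _) ht ?_
  rw [log_innerRadius hN, Finset.sum_range_succ]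
  rw [entropyRatio, lt_div_iff₀ (S.sum_log_m_pos hk0)] at hlt
  rw [div_le_iff₀ (by positivity)] at hk
  set Λ := ∑ i ∈ Finset.range k, Real.log (S.m i) with hΛ
  have h1 : (t' - t) * (k * Real.log 2) ≤ (t' - t) * Λ :=
    mul_le_mul_of_nonneg_left (S.mul_log_two_le k) hδ.le
  have h2 : (⌊ε * (k + 1 : ℕ)⌋₊ : ℝ) ≤ ε * (k + 1) := by
    have := Nat.floor_le (a := ε * (k + 1 : ℕ)) (by positivity)
    push_cast at this ⊢
    exact this
  have h3 : Real.log (S.m k) ≤ Real.log N := by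
    refine Real.log_le_log (by have := S.two_le_m k; positivity) (by exact_mod_cast (hN k).2)
  have h4 : (Λ + Real.log (S.m k) + (⌊ε * (k + 1 : ℕ)⌋₊ + 2) * Real.log N) * t ≤
      (Λ + Real.log N + (ε * (k + 1) + 2) * Real.log N) * t := by gcongr
  have h5 : ε * k * (1 + t * Real.log N) = (t' - t) * Real.log 2 / 2 * k := by
    rw [← hεmul]; ring
  linarith

/-! ### The four inequalities between dimensions and entropy ratios. -/

variable (p)

theorem hausdorffDimMeasure_moranMeasure_le (hN : ∀ k, S.n k ≤ N ∧ S.m k ≤ N) :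
    ((hausdorffDimMeasure (S.moranMeasure p) : ℝ≥0∞) : EReal) ≤
      liminf (fun k : ℕ => ((S.entropyRatio p k : ℝ) : EReal)) atTop := by
  refine le_of_forall_gt_imp_ge_of_dense fun b hb => ?_
  -- Two reals are inserted above the lower limit: the slack between `t'` and `t` absorbs the
  -- subexponential errors.
  obtain ⟨t, ht, htb⟩ := EReal.lt_iff_exists_real_btwn.1 hb
  obtain ⟨t', ht', htt⟩ := EReal.lt_iff_exists_real_btwn.1 ht
  rw [EReal.coe_lt_coe_iff] at htt
  have hfreq := frequently_lt_of_liminf_lt (h := ht')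
  simp only [EReal.coe_lt_coe_iff] at hfreq
  have ht0 : 0 ≤ t := by
    obtain ⟨k, hk⟩ := hfreq.exists
    linarith [S.entropyRatio_nonneg p k]
  refine le_trans ?_ htb.le
  lift t to ℝ≥0 using ht0
  obtain ⟨ε, hε, hexp⟩ := eventually_rpow_le_exp (S := S) p t.2 htt
  have := hausdorffDimMeasure_le (μ := S.moranMeasure p) (ρ := fun k => 2 * cellLength S.m k)
    (by simpa using S.tendsto_cellLength_m.const_mul 2)
    (fun k => by have := cellLength_pos S.two_le_m k; positivity) t (by
      filter_upwards [ae_eventually_le_moranMeasure_closedBall p hN hε] with x hx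
      refine (hfreq.and_eventually (hx.and hexp)).mono fun k hk => ?_
      exact (hk.2.2 hk.1).trans hk.2.1)
  rw [← EReal.coe_nnreal_eq_coe_real]
  exact_mod_cast this

theorem packingDimMeasure_moranMeasure_le (hN : ∀ k, S.n k ≤ N ∧ S.m k ≤ N) :
    ((packingDimMeasure (S.moranMeasure p) : ℝ≥0∞) : EReal) ≤
      limsup (fun k : ℕ => ((S.entropyRatio p k : ℝ) : EReal)) atTop := by
  refine le_of_forall_gt_imp_ge_of_dense fun b hb => ?_
  obtain ⟨t, ht, htb⟩ := EReal.lt_iff_exists_real_btwn.1 hb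
  obtain ⟨t', ht', htt⟩ := EReal.lt_iff_exists_real_btwn.1 ht
  rw [EReal.coe_lt_coe_iff] at htt
  have hev := eventually_lt_of_limsup_lt (h := ht')
  simp only [EReal.coe_lt_coe_iff] at hev
  have ht0 : 0 ≤ t := by
    obtain ⟨k, hk⟩ := hev.exists
    linarith [S.entropyRatio_nonneg p k]
  refine le_trans ?_ htb.le
  lift t to ℝ≥0 using ht0
  obtain ⟨ε, hε, hexp⟩ := eventually_rpow_le_exp (S := S) p t.2 htt
  have := packingDimMeasure_le (μ := S.moranMeasure p) (ρ := fun k => 2 * cellLength S.m k)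
    (by simpa using S.tendsto_cellLength_m.const_mul 2)
    (fun k => by have := cellLength_pos S.two_le_m k; positivity) (C := N) (fun k => by
      have h1 := cellLength_pos S.two_le_m (k + 1)
      have h2 : (S.m k : ℝ) ≤ N := by exact_mod_cast (hN k).2
      rw [cellLength_eq_mul S.two_le_m k]
      nlinarith) t (by
      filter_upwards [ae_eventually_le_moranMeasure_closedBall p hN hε] with x hx
      filter_upwards [hx, hexp, hev] with k h1 h2 h3
      exact (h2 h3).trans h1)
  rw [← EReal.coe_nnreal_eq_coe_real]
  exact_mod_cast this

variable {p}

theorem le_hausdorffDimMeasure_moranMeasure (hN : ∀ k, S.n k ≤ N ∧ S.m k ≤ N)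
    (hsep : S.FSC ∨ S.MSC p) :
    liminf (fun k : ℕ => ((S.entropyRatio p k : ℝ) : EReal)) atTop ≤
      ((hausdorffDimMeasure (S.moranMeasure p) : ℝ≥0∞) : EReal) := by
  refine le_of_forall_lt_imp_le_of_dense fun a ha => ?_
  obtain ⟨t, hat, ht⟩ := EReal.lt_iff_exists_real_btwn.1 ha
  refine hat.le.trans ?_
  rcases lt_or_ge t 0 with ht0 | ht0
  · exact (EReal.coe_le_coe_iff.2 ht0.le).trans (EReal.coe_ennreal_nonneg _)
  obtain ⟨t', htt, ht'⟩ := EReal.lt_iff_exists_real_btwn.1 ht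
  rw [EReal.coe_lt_coe_iff] at htt
  have hev := eventually_lt_of_lt_liminf (h := ht')
  simp only [EReal.coe_lt_coe_iff] at hev
  lift t to ℝ≥0 using ht0
  obtain ⟨ε, hε, hexp⟩ := eventually_exp_le_rpow (p := p) hN t.2 htt
  have := le_hausdorffDimMeasure (IsProbabilityMeasure.ne_zero (S.moranMeasure p))
    (tendsto_innerRadius hN ε) (innerRadius_pos hN ε) t (by
      filter_upwards [ae_eventually_moranMeasure_closedBall_le hN hsep hε] with x hx
      filter_upwards [hx, hexp, hev] with k h1 h2 h3
      exact h1.trans (h2 h3))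
  rw [← EReal.coe_nnreal_eq_coe_real]
  exact_mod_cast this

theorem le_packingDimMeasure_moranMeasure (hN : ∀ k, S.n k ≤ N ∧ S.m k ≤ N)
    (hsep : S.FSC ∨ S.MSC p) :
    limsup (fun k : ℕ => ((S.entropyRatio p k : ℝ) : EReal)) atTop ≤
      ((packingDimMeasure (S.moranMeasure p) : ℝ≥0∞) : EReal) := by
  refine le_of_forall_lt_imp_le_of_dense fun a ha => ?_
  obtain ⟨t, hat, ht⟩ := EReal.lt_iff_exists_real_btwn.1 ha
  refine hat.le.trans ?_
  rcases lt_or_ge t 0 with ht0 | ht0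
  · exact (EReal.coe_le_coe_iff.2 ht0.le).trans (EReal.coe_ennreal_nonneg _)
  obtain ⟨t', htt, ht'⟩ := EReal.lt_iff_exists_real_btwn.1 ht
  rw [EReal.coe_lt_coe_iff] at htt
  have hfreq := frequently_lt_of_lt_limsup (h := ht')
  simp only [EReal.coe_lt_coe_iff] at hfreq
  lift t to ℝ≥0 using ht0
  obtain ⟨ε, hε, hexp⟩ := eventually_exp_le_rpow (p := p) hN t.2 htt
  have := le_packingDimMeasure (IsProbabilityMeasure.ne_zero (S.moranMeasure p))
    (tendsto_innerRadius hN ε) (innerRadius_pos hN ε) t (by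
      filter_upwards [ae_eventually_moranMeasure_closedBall_le hN hsep hε] with x hx
      refine (hfreq.and_eventually (hx.and hexp)).mono fun k hk => ?_
      -- The packing criterion compares at the same scale `k`, so the bound at radius index `k + 1`
      -- is weakened.
      refine hk.2.1.trans ((hk.2.2 hk.1).trans ?_)
      exact ENNReal.rpow_le_rpow (ENNReal.ofReal_le_ofReal (innerRadius_succ_le hN hε k))
        t.coe_nonneg)
  rw [← EReal.coe_nnreal_eq_coe_real]
  exact_mod_cast this

end MoranData

end

theorem theorem2p2 (S : MoranData)
    (hN : ∃ N : ℕ, ∀ k, S.n k ≤ N ∧ S.m k ≤ N)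
    (p : S.ProbSeq) (hsep : S.FSC ∨ S.MSC p) :
    ((hausdorffDimMeasure (S.moranMeasure p) : ℝ≥0∞) : EReal) =
        liminf (fun k : ℕ => ((S.entropyRatio p k : ℝ) : EReal)) atTop ∧
      ((packingDimMeasure (S.moranMeasure p) : ℝ≥0∞) : EReal) =
        limsup (fun k : ℕ => ((S.entropyRatio p k : ℝ) : EReal)) atTop := by
  obtain ⟨N, hN⟩ := hN
  exact ⟨le_antisymm (S.hausdorffDimMeasure_moranMeasure_le p hN)
      (S.le_hausdorffDimMeasure_moranMeasure hN hsep),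
    le_antisymm (S.packingDimMeasure_moranMeasure_le p hN)
      (S.le_packingDimMeasure_moranMeasure hN hsep)⟩
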